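/- **Theorem.** Write $\log=\log_2$. Consider the linear contextual bandit with stochastic contexts: there are a hidden vector $\theta\in\mathbb R^d$ with $\|\theta\|\le 1$ and a distribution $\mathcal D$ on $K$-tuples of vectors of $\mathbb R^d$ of Euclidean norm at most $1$ (almost surely). At each time $t=1,\dots,T$ a tuple $X_t=(x_{t1},\dots,x_{tK})\sim\mathcal D$, independent of the past, is shown, the learner plays an arm $i_t\in[K]$ and receives $r_t=\theta^\top x_{t,i_t}+\varepsilon_t$, where $\varepsilon_t$ is sub-Gaussian with variance proxy at most $1$ and is independent of the past, of $X_t$ and of $i_t$. In the batch model with grid $0=\mathcal T_0<\mathcal T_1<\dots<\mathcal T_M=T$, a single (randomized) arm-selection policy, depending only on what was observed in the earlier batches, is used throughout batch $k=\{\mathcal T_{k-1}+1,\dots,\mathcal T_k\}$. Let $0<\delta<1$. The algorithm BatchLinUCB uses $M=\lceil\log\log T\rceil$ batches, with $\mathcal T_0=0$, $\mathcal T_i=\lfloor T^{1-2^{-i}}\rfloor$ for $1\le i<M$, and $\mathcal T_M=T$. Put $\alpha=10\sqrt{\ln(2dKT/\delta)}$ and $\lambda=16\ln(2dT/\delta)$,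 and for each batch $k$ let $\Lambda_k=\lambda I+\sum_{t\in\text{batch }k}x_{t,i_t}x_{t,i_t}^\top$, $\hat\theta_k=\Lambda_k^{-1}\sum_{t\in\text{batch }k}r_t x_{t,i_t}$. At a time $t$ in batch $k$ start with $A_t^{(0)}=[K]$; for $\kappa=1,\dots,k-1$ let $$A_t^{(\kappa)}=\{i\in A_t^{(\kappa-1)}:\ x_{ti}^\top\hat\theta_\kappa+\omega^{(\kappa)}_{ti}\ge x_{tj}^\top\hat\theta_\kappa-\omega^{(\kappa)}_{tj}\ \ \forall j\in A_t^{(\kappa-1)}\},\qquad \omega^{(\kappa)}_{ti}=\alpha\sqrt{x_{ti}^\top\Lambda_\kappa^{-1}x_{ti}};$$ then play $i_t$ uniformly at random from $A_t^{(k-1)}$. There is a universal constant $C>0$ such that, for all $d,K\ge1$, $T\ge3$ and $0<\delta<1$, BatchLinUCB is a batch learner in the above sense (in particular its grid is strictly increasing), its number of batches satisfies $M\le C\log\log T$, and for all $\mathcal D$, $\theta$ and noises as above its $(1-\delta)$-high probability expected regret satisfies $$\sup_{A:\ \Pr[A]\ge1-\delta}\ \mathbb E\Big[\mathbf 1_A\sum_{t=1}^T\Big(\max_{i\in[K]}x_{ti}^\top\theta-x_{t,i_t}^\top\theta\Big)\Big]\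 \le\ C\,\sqrt{dKT\log(dKT/\delta)}\ \log\log T,$$ where the supremum is over all events $A$ with $\Pr[A]\ge1-\delta$. -/

import Mathlib

open MeasureTheory ProbabilityTheory
open scoped ENNReal

/-! ### Linear contextual bandits with stochastic contexts, batch learning model -/

/-- The context vectors of the `K` arms at one time step. -/
abbrev Contexts (d K : ℕ) : Type := Fin K → EuclideanSpace ℝ (Fin d)

/-- What the learner sees at one time step: the contexts, the arm played, the reward received. -/
abbrev Observation (d K : ℕ) : Type := Contexts d K × Fin K × ℝ

/-- A learner in the batch model. The `k`-th batch (`1 ≤ k ≤ numBatches`) consists of the time steps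
`grid (k - 1) + 1, …, grid k`; `policy k h` is the action-selection policy used throughout the
`k`-th batch when the sequence of observations is `h`: it maps the contexts to a distribution
over the arms. See `BatchLearner.IsBatched` for the constraints of the batch model. -/
structure BatchLearner (d K : ℕ) where
  numBatches : ℕ
  grid : ℕ → ℕ
  policy : ℕ → (ℕ → Observation d K) → Contexts d K → PMF (Fin K)

/-- The constraints of the batch model with horizon `T`: the grid satisfies
`0 = 𝒯₀ < 𝒯₁ < ⋯ < 𝒯_M = T`, and the policy of each batch depends only on observations made in the
previous batches. -/
structure BatchLearner.IsBatched {d K : ℕ} (L : BatchLearner d K) (T : ℕ) : Prop where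
  grid_zero : L.grid 0 = 0
  grid_lt : ∀ k < L.numBatches, L.grid k < L.grid (k + 1)
  grid_last : L.grid L.numBatches = T
  policy_congr : ∀ k < L.numBatches, ∀ h h' : ℕ → Observation d K,
    (∀ s ∈ Finset.Icc 1 (L.grid k), h s = h' s) → L.policy (k + 1) h = L.policy (k + 1) h'

section Model

variable {d K : ℕ} {Ω : Type*}

/-- The observation at time `t`; the reward is `θᵀ x_{t, i_t} + ε_t`. -/
noncomputable def observation (θ : EuclideanSpace ℝ (Fin d)) (X : ℕ → Ω → Contexts d K)
    (a : ℕ → Ω → Fin K) (ε : ℕ → Ω → ℝ) (t : ℕ) (ω : Ω) : Observation d K :=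
  (X t ω, a t ω, inner ℝ θ (X t ω (a t ω)) + ε t ω)

/-- The σ-algebra generated by the observations at the time steps `1, …, t - 1`. -/
@[reducible] noncomputable def pastSigma (θ : EuclideanSpace ℝ (Fin d)) (X : ℕ → Ω → Contexts d K)
    (a : ℕ → Ω → Fin K) (ε : ℕ → Ω → ℝ) (t : ℕ) : MeasurableSpace Ω :=
  ⨆ s ∈ Finset.Ico 1 t, MeasurableSpace.comap (observation θ X a ε s) inferInstance

/-- The regret `∑ₜ (maxᵢ x_{ti}ᵀ θ - x_{t,i_t}ᵀ θ)` along a trajectory. -/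
noncomputable def regret (T : ℕ) (θ : EuclideanSpace ℝ (Fin d)) (X : ℕ → Ω → Contexts d K)
    (a : ℕ → Ω → Fin K) (ω : Ω) : ℝ :=
  ∑ t ∈ Finset.Icc 1 T, ((⨆ i : Fin K, inner ℝ (X t ω i) θ) - inner ℝ (X t ω (a t ω)) θ)

/-- The `(1 - δ)`-high probability expected regret: the supremum of `𝔼[𝟙_A · regret]` over all
events `A` of probability at least `1 - δ`. (The regret is nonnegative, so the expectation is
a Lebesgue integral with values in `[0, ∞]`.) -/
noncomputable def hpExpectedRegret [MeasurableSpace Ω] (μ : Measure Ω) (δ : ℝ) (T : ℕ)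
    (θ : EuclideanSpace ℝ (Fin d)) (X : ℕ → Ω → Contexts d K) (a : ℕ → Ω → Fin K) : ℝ≥0∞ :=
  ⨆ (A : Set Ω) (_ : MeasurableSet A) (_ : ENNReal.ofReal (1 - δ) ≤ μ A),
    ∫⁻ ω in A, ENNReal.ofReal (regret T θ X a ω) ∂μ

/-- `X`, `a`, `ε` are the contexts, the arms played and the noises (at the time steps `1, …, T`)
when the batch learner `L` plays the stochastic-context linear bandit with context distribution
`D` and hidden vector `θ`. -/
structure IsBanditRun [MeasurableSpace Ω] (μ : Measure Ω) (L : BatchLearner d K) (T : ℕ)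
    (D : Measure (Contexts d K)) (θ : EuclideanSpace ℝ (Fin d)) (X : ℕ → Ω → Contexts d K)
    (a : ℕ → Ω → Fin K) (ε : ℕ → Ω → ℝ) : Prop where
  measurable_context : ∀ t, Measurable (X t)
  measurable_arm : ∀ t, Measurable (a t)
  measurable_noise : ∀ t, Measurable (ε t)
  /-- The contexts are drawn from `D`, independently of the past. -/
  context_law : ∀ t ∈ Finset.Icc 1 T, μ.map (X t) = D
  context_indep : ∀ t ∈ Finset.Icc 1 T,
    Indep (MeasurableSpace.comap (X t) inferInstance) (pastSigma θ X a ε t) μ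
  /-- Given the past and the current contexts, the arm is drawn from the policy of the current
  batch. -/
  arm_law : ∀ k < L.numBatches, ∀ t ∈ Finset.Ioc (L.grid k) (L.grid (k + 1)), ∀ i : Fin K,
    μ[(a t ⁻¹' {i}).indicator (fun _ => (1 : ℝ)) |
        pastSigma θ X a ε t ⊔ MeasurableSpace.comap (X t) inferInstance]
      =ᵐ[μ] fun ω =>
        (L.policy (k + 1) (fun s => observation θ X a ε s ω) (X t ω) i).toReal
  /-- The noise is independent of the past, of the current contexts and of the current arm, and
  sub-Gaussian with variance proxy at most `1`. -/
  noise_indep : ∀ t ∈ Finset.Icc 1 T,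
    Indep (MeasurableSpace.comap (ε t) inferInstance)
      (pastSigma θ X a ε t ⊔ MeasurableSpace.comap (X t) inferInstance
        ⊔ MeasurableSpace.comap (a t) inferInstance) μ
  noise_subgaussian : ∀ t ∈ Finset.Icc 1 T, HasSubgaussianMGF (ε t) 1 μ

end Model

/-! ### The algorithm BatchLinUCB -/

namespace BatchLinUCB

/-- The number of batches `M = ⌈log₂ log₂ T⌉`. -/
noncomputable def numBatches (T : ℕ) : ℕ := ⌈Real.logb 2 (Real.logb 2 (T : ℝ))⌉₊

/-- The grid `𝒯₀ = 0`, `𝒯ᵢ = ⌊T ^ (1 - 2⁻ⁱ)⌋` for `1 ≤ i < M`, `𝒯_M = T`. -/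
noncomputable def grid (T i : ℕ) : ℕ :=
  if i = 0 then 0
  else if i < numBatches T then ⌊(T : ℝ) ^ (1 - (2 : ℝ)⁻¹ ^ i)⌋₊
  else T

variable {d K : ℕ}

/-- `α = 10 √(ln (2dKT/δ))`. -/
noncomputable def alpha (d K T : ℕ) (δ : ℝ) : ℝ :=
  10 * Real.sqrt (Real.log (2 * d * K * T / δ))

/-- `λ = 16 ln (2dT/δ)`. -/
noncomputable def lam (d T : ℕ) (δ : ℝ) : ℝ := 16 * Real.log (2 * d * T / δ)

/-- The context vector of the arm played at time `t`. -/
def played (h : ℕ → Observation d K) (t : ℕ) : Fin d → ℝ := ((h t).1 (h t).2.1).ofLp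

/-- `Λ_k = λ I + ∑ x_t x_tᵀ`, the sum over the `k`-th batch. -/
noncomputable def infoMatrix (T : ℕ) (δ : ℝ) (h : ℕ → Observation d K) (k : ℕ) :
    Matrix (Fin d) (Fin d) ℝ :=
  lam d T δ • (1 : Matrix (Fin d) (Fin d) ℝ) +
    ∑ t ∈ Finset.Ioc (grid T (k - 1)) (grid T k), Matrix.vecMulVec (played h t) (played h t)

/-- `θ̂_k = Λ_k⁻¹ ∑ r_t x_t`, the sum over the `k`-th batch. -/
noncomputable def estimate (T : ℕ) (δ : ℝ) (h : ℕ → Observation d K) (k : ℕ) : Fin d → ℝ :=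
  (infoMatrix T δ h k)⁻¹.mulVec
    (∑ t ∈ Finset.Ioc (grid T (k - 1)) (grid T k), (h t).2.2 • played h t)

/-- The estimated mean reward `xᵀ θ̂_κ`. -/
noncomputable def estReward (T : ℕ) (δ : ℝ) (h : ℕ → Observation d K) (κ : ℕ)
    (x : EuclideanSpace ℝ (Fin d)) : ℝ :=
  dotProduct x.ofLp (estimate T δ h κ)

/-- The confidence width `α √(xᵀ Λ_κ⁻¹ x)`. -/
noncomputable def width (T : ℕ) (δ : ℝ) (h : ℕ → Observation d K) (κ : ℕ)
    (x : EuclideanSpace ℝ (Fin d)) : ℝ :=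
  alpha d K T δ * Real.sqrt (dotProduct x.ofLp ((infoMatrix T δ h κ)⁻¹.mulVec x.ofLp))

open Classical in
/-- The arms that survive the first `κ` eliminations (those based on batches `1, …, κ`). -/
noncomputable def survivors (T : ℕ) (δ : ℝ) (h : ℕ → Observation d K) (x : Contexts d K) :
    ℕ → Finset (Fin K)
  | 0 => Finset.univ
  | κ + 1 => (survivors T δ h x κ).filter fun i =>
      ∀ j ∈ survivors T δ h x κ,
        estReward T δ h (κ + 1) (x j) - width T δ h (κ + 1) (x j)
          ≤ estReward T δ h (κ + 1) (x i) + width T δ h (κ + 1) (x i)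

theorem survivors_nonempty [NeZero K] (T : ℕ) (δ : ℝ) (h : ℕ → Observation d K)
    (x : Contexts d K) (κ : ℕ) : (survivors T δ h x κ).Nonempty := by
  induction κ with
  | zero => exact ⟨0, Finset.mem_univ _⟩
  | succ κ ih =>
    obtain ⟨i, hi, hmax⟩ := Finset.exists_max_image (survivors T δ h x κ)
      (fun j => estReward T δ h (κ + 1) (x j) - width T δ h (κ + 1) (x j)) ih
    refine ⟨i, ?_⟩
    rw [survivors, Finset.mem_filter]
    refine ⟨hi, fun j hj => (hmax j hj).trans ?_⟩
    have hw : 0 ≤ width T δ h (κ + 1) (x i) := by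
      unfold width alpha
      positivity
    linarith

/-- BatchLinUCB: in the `k`-th batch, play an arm drawn uniformly from those that survive the
eliminations based on the batches `1, …, k - 1`. -/
noncomputable def learner (d K : ℕ) [NeZero K] (T : ℕ) (δ : ℝ) : BatchLearner d K where
  numBatches := numBatches T
  grid := grid T
  policy k h x :=
    PMF.uniformOfFinset (survivors T δ h x (k - 1)) (survivors_nonempty T δ h x (k - 1))

end BatchLinUCB

/-! The event of probability `1 - δ` plays no role beyond monotonicity: the unconditional expected
regret already obeys the bound, and the failure of confidence intervals is paid for inside the
expectation. The regret is bounded batch by batch by a constant times `√(L · dKT)`, where `L = ln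
(2dKT/δ)` is `confLog`, and there are `O(log log T)` batches.

Structure of a batch. Conditionally on the earlier batches, the observations of a batch are
independent, with contexts and arms from one common law. `lintegral_history_step` and
`lintegral_history_batch` express this by replacing observations of the run by fresh independent
samples. It has two consequences.

Confidence: once the played vectors are frozen, the ridge error at a fixed `y` is a bias plus a
linear combination of independent sub-Gaussian noises, whose squared weights sum to at most `yᵀ Λ⁻¹
y`. A Chernoff bound gives failure probability at most `2 exp (-18 L)` (`lintegral_confFail_le`).
Since the contexts are integrated separately from the history, `y` may be held fixed and no covering
argument is needed.

Exploration: let `y` be a fresh copy of the vectors `z_t` played in a batch of length `n`. Removing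
one `z_j` from `Λ` only increases `yᵀ Λ⁻¹ y`; then `z_j` can stand for `y`, and putting it back
costs a factor 2. As `∑ z_jᵀ Λ⁻¹ z_j ≤ d` by a trace identity, `n 𝔼[yᵀ Λ⁻¹ y] ≤ 2d`
(`card_mul_lmarginal_lintegral_invQuad_le`), without any matrix concentration. The played arm is
uniform among at most `K` survivors, so the sum of the squared unscaled widths of all survivors has
mean at most `2Kd/n` (`mul_lintegral_sumInvQuad_le`).

If all intervals are correct, an arm surviving the next elimination has gap at most four times the
largest such width times `α`. Hence each step of the following batch costs `O(α √(Kd/n))`. The grid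
is tuned so that the end point of a batch divided by the square root of the preceding batch's length
is `O(√T)` (`realGrid_succ_sq`, `grid_mul_sqrt_le`). The first batch has length `O(√T)` and is
bounded trivially. -/

/-! ### Regularized Gram matrices -/

section RegGram

variable {ι : Type*} {d : ℕ}

/-- The regularized Gram matrix `c I + ∑ z_t z_tᵀ`. -/
noncomputable def regGram (c : ℝ) (s : Finset ι) (z : ι → Fin d → ℝ) :
    Matrix (Fin d) (Fin d) ℝ :=
  c • (1 : Matrix (Fin d) (Fin d) ℝ) + ∑ t ∈ s, Matrix.vecMulVec (z t) (z t)

/-- The quadratic form `yᵀ G⁻¹ y` of the inverse of a regularized Gram matrix. -/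
noncomputable def invQuad (c : ℝ) (s : Finset ι) (z : ι → Fin d → ℝ) (y : Fin d → ℝ) : ℝ :=
  dotProduct y ((regGram c s z)⁻¹.mulVec y)

theorem regGram_mulVec (c : ℝ) (s : Finset ι) (z : ι → Fin d → ℝ) (u : Fin d → ℝ) :
    (regGram c s z).mulVec u = c • u + ∑ t ∈ s, (dotProduct (z t) u) • z t := by
  simp [regGram, Matrix.add_mulVec, Matrix.smul_mulVec, Matrix.sum_mulVec,
    Matrix.vecMulVec_mulVec]

theorem dotProduct_regGram_mulVec (c : ℝ) (s : Finset ι) (z : ι → Fin d → ℝ)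
    (v u : Fin d → ℝ) :
    dotProduct v ((regGram c s z).mulVec u)
      = c * dotProduct v u + ∑ t ∈ s, dotProduct (z t) u * dotProduct (z t) v := by
  simp only [regGram_mulVec, dotProduct_add, dotProduct_sum, dotProduct_smul, smul_eq_mul,
    dotProduct_comm v (z _)]

theorem regGram_isHermitian (c : ℝ) (s : Finset ι) (z : ι → Fin d → ℝ) :
    (regGram c s z).IsHermitian := by
  simp only [Matrix.IsHermitian, Matrix.conjTranspose_eq_transpose_of_trivial]
  simp [regGram, Matrix.transpose_sum, Matrix.transpose_vecMulVec]

theorem regGram_posDef {c : ℝ} (hc : 0 < c) (s : Finset ι) (z : ι → Fin d → ℝ) :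
    (regGram c s z).PosDef := by
  refine Matrix.PosDef.of_dotProduct_mulVec_pos (regGram_isHermitian c s z) fun x hx => ?_
  rw [star_trivial, dotProduct_regGram_mulVec]
  have h1 : 0 < dotProduct x x := by
    have := Matrix.dotProduct_star_self_pos_iff.2 hx
    simpa using this
  have h2 : 0 ≤ ∑ t ∈ s, dotProduct (z t) x * dotProduct (z t) x :=
    Finset.sum_nonneg fun t _ => mul_self_nonneg _
  positivity

theorem regGram_mulVec_inv_mulVec {c : ℝ} (hc : 0 < c) (s : Finset ι) (z : ι → Fin d → ℝ)
    (y : Fin d → ℝ) : (regGram c s z).mulVec ((regGram c s z)⁻¹.mulVec y) = y := by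
  rw [Matrix.mulVec_mulVec, Matrix.mul_nonsing_inv _
    ((Matrix.isUnit_iff_isUnit_det _).1 (regGram_posDef hc s z).isUnit), Matrix.one_mulVec]

theorem regGram_inv_mulVec_mulVec {c : ℝ} (hc : 0 < c) (s : Finset ι) (z : ι → Fin d → ℝ)
    (y : Fin d → ℝ) : (regGram c s z)⁻¹.mulVec ((regGram c s z).mulVec y) = y := by
  rw [Matrix.mulVec_mulVec, Matrix.nonsing_inv_mul _
    ((Matrix.isUnit_iff_isUnit_det _).1 (regGram_posDef hc s z).isUnit), Matrix.one_mulVec]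

theorem dotProduct_regGram_inv_mulVec_comm (c : ℝ) (s : Finset ι) (z : ι → Fin d → ℝ)
    (x y : Fin d → ℝ) :
    dotProduct x ((regGram c s z)⁻¹.mulVec y) = dotProduct ((regGram c s z)⁻¹.mulVec x) y := by
  have h := (regGram_isHermitian c s z).inv
  rw [Matrix.IsHermitian, Matrix.conjTranspose_eq_transpose_of_trivial] at h
  rw [Matrix.dotProduct_mulVec, ← Matrix.mulVec_transpose, h]

/-- With `u = G⁻¹ y`, `yᵀ G⁻¹ y = c ‖u‖² + ∑ (z_tᵀ u)²`. -/
theorem invQuad_eq {c : ℝ} (hc : 0 < c) (s : Finset ι) (z : ι → Fin d → ℝ) (y : Fin d → ℝ) :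
    invQuad c s z y
      = c * dotProduct ((regGram c s z)⁻¹.mulVec y) ((regGram c s z)⁻¹.mulVec y)
        + ∑ t ∈ s, dotProduct (z t) ((regGram c s z)⁻¹.mulVec y) ^ 2 := by
  have h := dotProduct_regGram_mulVec c s z ((regGram c s z)⁻¹.mulVec y)
    ((regGram c s z)⁻¹.mulVec y)
  rw [regGram_mulVec_inv_mulVec hc, dotProduct_comm] at h
  simpa [invQuad, sq] using h

theorem invQuad_nonneg {c : ℝ} (hc : 0 < c) (s : Finset ι) (z : ι → Fin d → ℝ)
    (y : Fin d → ℝ) : 0 ≤ invQuad c s z y := by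
  rw [invQuad_eq hc]
  have : 0 ≤ dotProduct ((regGram c s z)⁻¹.mulVec y) ((regGram c s z)⁻¹.mulVec y) := by
    simpa using dotProduct_star_self_nonneg ((regGram c s z)⁻¹.mulVec y)
  positivity

/-- Completing the square: the difference of the two sides is `(u - v)ᵀ G (u - v)` with `u = G⁻¹ y`.
This variational form of `yᵀ G⁻¹ y` allows Gram matrices to be compared through their forms, without
ordering their inverses. -/
theorem two_mul_dotProduct_sub_le_invQuad {c : ℝ} (hc : 0 < c) (s : Finset ι)
    (z : ι → Fin d → ℝ) (y v : Fin d → ℝ) :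
    2 * dotProduct y v - dotProduct v ((regGram c s z).mulVec v) ≤ invQuad c s z y := by
  set u := (regGram c s z)⁻¹.mulVec y with hu
  have h := (regGram_posDef hc s z).posSemidef.dotProduct_mulVec_nonneg (u - v)
  have hy : (regGram c s z).mulVec u = y := regGram_mulVec_inv_mulVec hc s z y
  have hsymm : dotProduct u ((regGram c s z).mulVec v) = dotProduct y v := by
    rw [← hy, dotProduct_comm _ v]
    simp only [dotProduct_regGram_mulVec, dotProduct_comm u v, mul_comm]
  rw [star_trivial, Matrix.mulVec_sub, sub_dotProduct, dotProduct_sub, dotProduct_sub, hsymm, hy,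
    dotProduct_comm u y, dotProduct_comm v y] at h
  have : invQuad c s z y = dotProduct y u := rfl
  linarith

theorem regGram_insert [DecidableEq ι] (c : ℝ) {s : Finset ι} {j : ι} (hj : j ∉ s)
    (z : ι → Fin d → ℝ) :
    regGram c (insert j s) z = regGram c s z + Matrix.vecMulVec (z j) (z j) := by
  rw [regGram, Finset.sum_insert hj, regGram]
  abel

/-- Test the variational bound for the smaller matrix with the maximizer `v` of the larger one; the
two values differ by the square `(z_jᵀ v)²`. -/
theorem invQuad_insert_le [DecidableEq ι] {c : ℝ} (hc : 0 < c) {s : Finset ι} {j : ι}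
    (hj : j ∉ s) (z : ι → Fin d → ℝ) (y : Fin d → ℝ) :
    invQuad c (insert j s) z y ≤ invQuad c s z y := by
  set v := (regGram c (insert j s) z)⁻¹.mulVec y with hv
  have h := two_mul_dotProduct_sub_le_invQuad hc s z y v
  have h1 : dotProduct v ((regGram c (insert j s) z).mulVec v) = invQuad c (insert j s) z y := by
    rw [hv, regGram_mulVec_inv_mulVec hc, dotProduct_comm, invQuad]
  have h2 : invQuad c (insert j s) z y = dotProduct y v := rfl
  rw [dotProduct_regGram_mulVec, Finset.sum_insert hj] at h1
  rw [dotProduct_regGram_mulVec] at h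
  nlinarith [mul_self_nonneg (dotProduct (z j) v)]

/-- With `u = G⁻¹ y` and `1 ≤ c` one has `uᵀu ≤ yᵀu`, and `2 yᵀu ≤ yᵀy + uᵀu` gives the claim. -/
theorem invQuad_le_dotProduct_self {c : ℝ} (hc : 1 ≤ c) (s : Finset ι) (z : ι → Fin d → ℝ)
    (y : Fin d → ℝ) : invQuad c s z y ≤ dotProduct y y := by
  have hc0 : 0 < c := by linarith
  set u := (regGram c s z)⁻¹.mulVec y with hu
  have h := invQuad_eq hc0 s z y
  rw [← hu] at h
  have hs : 0 ≤ ∑ t ∈ s, dotProduct (z t) u ^ 2 := Finset.sum_nonneg fun t _ => sq_nonneg _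
  have huu : 0 ≤ dotProduct u u := by simpa using dotProduct_star_self_nonneg u
  have hyu : 0 ≤ dotProduct (y - u) (y - u) := by
    simpa using dotProduct_star_self_nonneg (y - u)
  rw [sub_dotProduct, dotProduct_sub, dotProduct_sub, dotProduct_comm u y] at hyu
  have h2 : invQuad c s z y = dotProduct y u := rfl
  nlinarith

/-- Sherman–Morrison in the direction of the inserted vector: if `p` and `q` are the values before
and after the insertion, then `q = (1 - q) p`, that is `q = p / (1 + p)`. Since `c ≥ 1` and `z_j`
lies in the unit ball, `p ≤ 1`. -/
theorem invQuad_le_two_mul_insert [DecidableEq ι] {c : ℝ} (hc : 1 ≤ c) {s : Finset ι} {j : ι}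
    (hj : j ∉ s) (z : ι → Fin d → ℝ) (hz : dotProduct (z j) (z j) ≤ 1) :
    invQuad c s z (z j) ≤ 2 * invQuad c (insert j s) z (z j) := by
  have hc0 : 0 < c := by linarith
  set v := (regGram c (insert j s) z)⁻¹.mulVec (z j) with hv
  set q := invQuad c (insert j s) z (z j) with hq
  set p := invQuad c s z (z j) with hp
  have hqv : q = dotProduct (z j) v := rfl
  have h1 : (regGram c (insert j s) z).mulVec v = z j := regGram_mulVec_inv_mulVec hc0 _ z _
  rw [regGram_insert c hj, Matrix.add_mulVec, Matrix.vecMulVec_mulVec] at h1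
  have h2 : (regGram c s z).mulVec v = (1 - q) • z j := by
    rw [hqv, sub_smul, one_smul, eq_sub_iff_add_eq]
    simpa using h1
  have h3 : v = (1 - q) • (regGram c s z)⁻¹.mulVec (z j) := by
    rw [← Matrix.mulVec_smul, ← h2, regGram_inv_mulVec_mulVec hc0]
  have h4 : q = (1 - q) * p := by
    rw [hqv]
    nth_rewrite 1 [h3]
    rw [dotProduct_smul, ← hqv, smul_eq_mul, hp, invQuad]
  have hp1 : p ≤ 1 := (invQuad_le_dotProduct_self hc s z _).trans hz
  have hq0 : 0 ≤ q := invQuad_nonneg hc0 _ _ _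
  nlinarith

/-- Expand `d = tr (G⁻¹ G)` along the definition of `G`: the regularization contributes `c tr G⁻¹ ≥
0`, and each rank-one term contributes one summand. -/
theorem sum_invQuad_le {c : ℝ} (hc : 0 < c) (s : Finset ι) (z : ι → Fin d → ℝ) :
    ∑ t ∈ s, invQuad c s z (z t) ≤ d := by
  set G := regGram c s z with hG
  have hpos := regGram_posDef hc s z
  have h1 : G⁻¹ * G = 1 := Matrix.nonsing_inv_mul _
    ((Matrix.isUnit_iff_isUnit_det _).1 hpos.isUnit)
  have h2 : Matrix.trace (G⁻¹ * G) = d := by rw [h1]; simp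
  have h3 : Matrix.trace (G⁻¹ * G)
      = c * Matrix.trace G⁻¹ + ∑ t ∈ s, invQuad c s z (z t) := by
    nth_rewrite 2 [hG]
    rw [regGram, Matrix.mul_add, Matrix.trace_add, Finset.mul_sum, Matrix.trace_sum]
    congr 1
    · simp
    · refine Finset.sum_congr rfl fun t _ => ?_
      rw [Matrix.mul_vecMulVec, Matrix.trace_vecMulVec, dotProduct_comm]
      rfl
  have h4 : 0 ≤ Matrix.trace G⁻¹ := hpos.inv.posSemidef.trace_nonneg
  nlinarith [mul_nonneg hc.le h4]

/-- The bias of the ridge estimator. -/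
theorem mul_abs_dotProduct_inv_mulVec_le {c : ℝ} (hc : 0 < c) (s : Finset ι)
    (z : ι → Fin d → ℝ) (y θ : Fin d → ℝ) (hθ : dotProduct θ θ ≤ 1) :
    c * |dotProduct y ((regGram c s z)⁻¹.mulVec θ)|
      ≤ Real.sqrt c * Real.sqrt (invQuad c s z y) := by
  rw [dotProduct_regGram_inv_mulVec_comm]
  set u := (regGram c s z)⁻¹.mulVec y with hu
  have h := invQuad_eq hc s z y
  rw [← hu] at h
  have hs : 0 ≤ ∑ t ∈ s, dotProduct (z t) u ^ 2 := Finset.sum_nonneg fun t _ => sq_nonneg _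
  have huu : 0 ≤ dotProduct u u := by simpa using dotProduct_star_self_nonneg u
  have hcs : dotProduct u θ ^ 2 ≤ dotProduct u u * dotProduct θ θ := by
    simpa [dotProduct, sq] using Finset.sum_mul_sq_le_sq_mul_sq Finset.univ u θ
  rw [← Real.sqrt_mul hc.le]
  refine Real.le_sqrt_of_sq_le ?_
  rw [mul_pow, sq_abs]
  -- Cauchy–Schwarz with `‖θ‖ ≤ 1`; the rest is `c² ‖u‖² ≤ c · invQuad`, from the decomposition of
  -- `invQuad` in `h`.
  have : dotProduct u θ ^ 2 ≤ dotProduct u u := by nlinarith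
  nlinarith [mul_le_mul_of_nonneg_left this (sq_nonneg c), mul_nonneg hc.le hs]

/-- These are the squared weights of the noises in the ridge error at `y`, so the variance proxy of
the noise part is at most the squared unscaled width. -/
theorem sum_dotProduct_inv_mulVec_sq_le {c : ℝ} (hc : 0 < c) (s : Finset ι)
    (z : ι → Fin d → ℝ) (y : Fin d → ℝ) :
    ∑ t ∈ s, dotProduct y ((regGram c s z)⁻¹.mulVec (z t)) ^ 2 ≤ invQuad c s z y := by
  rw [invQuad_eq hc]
  have huu : 0 ≤ dotProduct ((regGram c s z)⁻¹.mulVec y) ((regGram c s z)⁻¹.mulVec y) := by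
    simpa using dotProduct_star_self_nonneg ((regGram c s z)⁻¹.mulVec y)
  have : ∀ t, dotProduct y ((regGram c s z)⁻¹.mulVec (z t))
      = dotProduct (z t) ((regGram c s z)⁻¹.mulVec y) := fun t => by
    rw [dotProduct_regGram_inv_mulVec_comm, dotProduct_comm]
  simp only [this]
  nlinarith [mul_nonneg hc.le huu]

/-- The error of the ridge estimator for the rewards `r_t = z_tᵀ θ + e_t`: bias plus noise. -/
theorem dotProduct_ridge_sub {c : ℝ} (hc : 0 < c) (s : Finset ι)
    (z : ι → Fin d → ℝ) (y θ : Fin d → ℝ) (r : ι → ℝ) :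
    dotProduct y ((regGram c s z)⁻¹.mulVec (∑ t ∈ s, r t • z t)) - dotProduct y θ
      = ∑ t ∈ s, dotProduct y ((regGram c s z)⁻¹.mulVec (z t)) * (r t - dotProduct (z t) θ)
        - c * dotProduct y ((regGram c s z)⁻¹.mulVec θ) := by
  -- Expand `θ = G⁻¹ (G θ)`: the Gram part cancels the noiseless rewards and the regularization
  -- leaves the bias.
  have h1 : θ = c • (regGram c s z)⁻¹.mulVec θ
      + ∑ t ∈ s, dotProduct (z t) θ • (regGram c s z)⁻¹.mulVec (z t) := by
    conv_lhs => rw [← regGram_inv_mulVec_mulVec hc s z θ, regGram_mulVec, Matrix.mulVec_add,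
      Matrix.mulVec_smul, Matrix.mulVec_sum]
    simp [Matrix.mulVec_smul]
  have h2 : dotProduct y θ = c * dotProduct y ((regGram c s z)⁻¹.mulVec θ)
      + ∑ t ∈ s, dotProduct (z t) θ * dotProduct y ((regGram c s z)⁻¹.mulVec (z t)) := by
    conv_lhs => rw [h1]
    simp [dotProduct_add, dotProduct_sum]
  rw [h2, Matrix.mulVec_sum, dotProduct_sum]
  simp only [Matrix.mulVec_smul, dotProduct_smul, smul_eq_mul, mul_sub, Finset.sum_sub_distrib]
  simp only [mul_comm]
  ring

end RegGram

/-! ### The law of one observation -/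

section ObsLaw

variable {d K : ℕ}

/-- The law of the contexts and the arm, when the contexts have the law `D` and the arm is drawn
from the policy `q`. -/
noncomputable def armLaw (D : Measure (Contexts d K)) (q : Contexts d K → PMF (Fin K)) :
    Measure (Contexts d K × Fin K) :=
  ∑ i, (D.withDensity fun x => q x i).map fun x => (x, i)

theorem lintegral_armLaw (D : Measure (Contexts d K)) {q : Contexts d K → PMF (Fin K)}
    (hq : ∀ i, Measurable fun x => q x i) {f : Contexts d K × Fin K → ℝ≥0∞} (hf : Measurable f) :
    ∫⁻ z, f z ∂armLaw D q = ∑ i, ∫⁻ x, q x i * f (x, i) ∂D := by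
  rw [armLaw, lintegral_finsetSum_measure]
  refine Finset.sum_congr rfl fun i _ => ?_
  rw [lintegral_map hf (by fun_prop), lintegral_withDensity_eq_lintegral_mul _ (hq i) (by fun_prop)]
  rfl

theorem isProbabilityMeasure_armLaw (D : Measure (Contexts d K)) [IsProbabilityMeasure D]
    {q : Contexts d K → PMF (Fin K)} (hq : ∀ i, Measurable fun x => q x i) :
    IsProbabilityMeasure (armLaw D q) := by
  constructor
  have h := lintegral_armLaw D hq (f := fun _ => 1) measurable_const
  simp only [lintegral_const, one_mul, mul_one] at h
  rw [h, ← lintegral_finsetSum _ fun i _ => hq i]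
  have : ∀ x, ∑ i, q x i = 1 := fun x => by
    rw [← tsum_fintype (L := .unconditional _)]; exact (q x).tsum_coe
  simp [this]

/-- Contexts, arm and noise determine the observation. -/
noncomputable def toObs (θ : EuclideanSpace ℝ (Fin d)) (p : (Contexts d K × Fin K) × ℝ) :
    Observation d K :=
  (p.1.1, p.1.2, inner ℝ θ (p.1.1 p.1.2) + p.2)

theorem measurable_playedContext : Measurable fun p : Contexts d K × Fin K => p.1 p.2 :=
  measurable_from_prod_countable_left fun i => measurable_pi_apply i

theorem measurable_toObs (θ : EuclideanSpace ℝ (Fin d)) :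
    Measurable (toObs θ : (Contexts d K × Fin K) × ℝ → Observation d K) := by
  have : Measurable fun p : (Contexts d K × Fin K) × ℝ => p.1.1 p.1.2 :=
    measurable_playedContext.comp measurable_fst
  unfold toObs
  fun_prop

/-- The law of an observation whose contexts and arm have the law `α` and whose noise has the
law `η`. -/
noncomputable def obsLaw (θ : EuclideanSpace ℝ (Fin d)) (α : Measure (Contexts d K × Fin K))
    (η : Measure ℝ) : Measure (Observation d K) :=
  (α.prod η).map (toObs θ)

theorem isProbabilityMeasure_obsLaw (θ : EuclideanSpace ℝ (Fin d))
    (α : Measure (Contexts d K × Fin K)) (η : Measure ℝ) [IsProbabilityMeasure α]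
    [IsProbabilityMeasure η] : IsProbabilityMeasure (obsLaw θ α η) :=
  Measure.isProbabilityMeasure_map (measurable_toObs θ).aemeasurable

theorem lintegral_obsLaw (θ : EuclideanSpace ℝ (Fin d)) (α : Measure (Contexts d K × Fin K))
    (η : Measure ℝ) [SFinite η] {f : Observation d K → ℝ≥0∞} (hf : Measurable f) :
    ∫⁻ z, f z ∂obsLaw θ α η = ∫⁻ z, ∫⁻ e, f (toObs θ (z, e)) ∂η ∂α := by
  rw [obsLaw, lintegral_map hf (measurable_toObs θ),
    lintegral_prod (fun p => f (toObs θ p)) (hf.comp (measurable_toObs θ)).aemeasurable]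

end ObsLaw

/-! ### Integrating out conditionally independent variables -/

section Conditioning

variable {Ω : Type*}

/-- The hypothesis says that the restriction of `μ` to `s` and the measure with density `P` agree on
`m`. They therefore integrate every nonnegative `m`-measurable `W` equally, with no integrability
assumption. -/
theorem setLIntegral_eq_of_condExp {m m0 : MeasurableSpace Ω} {μ : Measure Ω}
    [IsFiniteMeasure μ] (hm : m ≤ m0) {s : Set Ω} (hs : MeasurableSet s) {P : Ω → ℝ≥0∞}
    (hP : Measurable P) (hP1 : ∀ ω, P ω ≤ 1)
    (h : μ[s.indicator (fun _ => (1 : ℝ)) | m] =ᵐ[μ] fun ω => (P ω).toReal)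
    {W : Ω → ℝ≥0∞} (hW : Measurable[m] W) :
    ∫⁻ ω in s, W ω ∂μ = ∫⁻ ω, P ω * W ω ∂μ := by
  have key : (μ.restrict s).trim hm = (μ.withDensity P).trim hm := by
    refine @Measure.ext _ m _ _ fun A hA => ?_
    rw [trim_measurableSet_eq hm hA, trim_measurableSet_eq hm hA, Measure.restrict_apply (hm _ hA),
      withDensity_apply _ (hm _ hA)]
    have hint : Integrable (s.indicator fun _ => (1 : ℝ)) μ :=
      (integrable_const 1).indicator hs
    have h1 := setIntegral_condExp hm hint hA
    rw [setIntegral_congr_ae (hm _ hA) (h.mono fun ω hω _ => hω), integral_indicator hs,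
      Measure.restrict_restrict hs, setIntegral_const, smul_eq_mul, mul_one, Set.inter_comm] at h1
    have h2 : ∫⁻ ω in A, P ω ∂μ = ENNReal.ofReal (∫ ω in A, (P ω).toReal ∂μ) := by
      rw [integral_toReal hP.aemeasurable (ae_of_all _ fun ω => (hP1 ω).trans_lt ENNReal.one_lt_top),
        ENNReal.ofReal_toReal]
      refine ne_top_of_le_ne_top (measure_ne_top μ A) ?_
      calc ∫⁻ ω in A, P ω ∂μ ≤ ∫⁻ ω in A, 1 ∂μ := lintegral_mono fun ω => hP1 ω
        _ = μ A := by simp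
    rw [h2, h1, measureReal_def, ENNReal.ofReal_toReal (measure_ne_top _ _)]
  rw [← lintegral_trim hm hW, key, lintegral_trim hm hW,
    lintegral_withDensity_eq_lintegral_mul _ hP (hW.mono hm le_rfl)]
  rfl

theorem lintegral_eq_lintegral_of_indepFun {α β : Type*} [MeasurableSpace α] [MeasurableSpace β]
    [MeasurableSpace Ω] {μ : Measure Ω} [IsFiniteMeasure μ] {U : Ω → α} {V : Ω → β}
    (hU : Measurable U) (hV : Measurable V) (h : IndepFun U V μ) {f : α × β → ℝ≥0∞}
    (hf : Measurable f) :
    ∫⁻ ω, f (U ω, V ω) ∂μ = ∫⁻ ω, ∫⁻ v, f (U ω, v) ∂μ.map V ∂μ := by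
  have h1 := (indepFun_iff_map_prod_eq_prod_map_map hU.aemeasurable hV.aemeasurable).1 h
  rw [← lintegral_map hf (hU.prodMk hV), h1, lintegral_prod _ hf.aemeasurable,
    lintegral_map hf.lintegral_prod_right' hU]

end Conditioning

/-! ### Resampling the observations of a batch -/

section Resampling

variable {d K : ℕ} {Ω : Type*} [MeasurableSpace Ω] {μ : Measure Ω} {L : BatchLearner d K}
  {T : ℕ} {D : Measure (Contexts d K)}
  {θ : EuclideanSpace ℝ (Fin d)} {X : ℕ → Ω → Contexts d K}
  {a : ℕ → Ω → Fin K} {ε : ℕ → Ω → ℝ}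

/-- The sequence of all observations. -/
noncomputable def history (θ : EuclideanSpace ℝ (Fin d)) (X : ℕ → Ω → Contexts d K)
    (a : ℕ → Ω → Fin K) (ε : ℕ → Ω → ℝ) (ω : Ω) : ℕ → Observation d K :=
  fun s => observation θ X a ε s ω

theorem IsBanditRun.measurable_observation (hrun : IsBanditRun μ L T D θ X a ε) (t : ℕ) :
    Measurable (observation θ X a ε t) :=
  (measurable_toObs θ).comp
    (((hrun.measurable_context t).prodMk (hrun.measurable_arm t)).prodMk (hrun.measurable_noise t))

theorem IsBanditRun.measurable_history (hrun : IsBanditRun μ L T D θ X a ε) :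
    Measurable (history θ X a ε) :=
  measurable_pi_lambda _ fun t => hrun.measurable_observation t

theorem BatchLearner.IsBatched.grid_mono (hL : L.IsBatched T) {i j : ℕ} (hij : i ≤ j)
    (hj : j ≤ L.numBatches) : L.grid i ≤ L.grid j := by
  induction j, hij using Nat.le_induction with
  | base => exact le_rfl
  | succ n _ ih => exact (ih (by omega)).trans (hL.grid_lt n (by omega)).le

/-- The law of the observation at a time `t` of the `k`-th batch, given the previous batches. -/
noncomputable def BatchLearner.stepLaw (L : BatchLearner d K) (D : Measure (Contexts d K))
    (θ : EuclideanSpace ℝ (Fin d)) (η : ℕ → Measure ℝ) (k : ℕ) (h : ℕ → Observation d K)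
    (t : ℕ) : Measure (Observation d K) :=
  obsLaw θ (armLaw D (L.policy k h)) (η t)

/-- Measurability of the policies of a learner. -/
def BatchLearner.MeasurablePolicy (L : BatchLearner d K) : Prop :=
  ∀ k i, Measurable fun p : (ℕ → Observation d K) × Contexts d K => L.policy k p.1 p.2 i

theorem BatchLearner.MeasurablePolicy.policy (hmeas : L.MeasurablePolicy) (k : ℕ)
    (h : ℕ → Observation d K) (i : Fin K) : Measurable fun x => L.policy k h x i :=
  (hmeas k i).comp (measurable_const.prodMk measurable_id)

/-- The observation at time `t` may be redrawn from its conditional law. Working with integrals of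
functions of the history avoids constructing conditional distributions. -/
theorem lintegral_history_step [NeZero K] [IsProbabilityMeasure μ] [IsProbabilityMeasure D]
    (hrun : IsBanditRun μ L T D θ X a ε) (hL : L.IsBatched T) (hmeas : L.MeasurablePolicy)
    {k : ℕ} (hk : k < L.numBatches) {t : ℕ} (ht : t ∈ Finset.Ioc (L.grid k) (L.grid (k + 1)))
    {g : (ℕ → Observation d K) → ℝ≥0∞} (hg : Measurable g) (hgt : DependsOn g (Set.Icc 1 t)) :
    ∫⁻ ω, g (history θ X a ε ω) ∂μ
      = ∫⁻ ω, ∫⁻ z, g (Function.update (history θ X a ε ω) t z)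
          ∂L.stepLaw D θ (fun s => μ.map (ε s)) (k + 1) (history θ X a ε ω) t ∂μ := by
  have ht' := Finset.mem_Ioc.1 ht
  have htT : t ∈ Finset.Icc 1 T := by
    have := hL.grid_mono (Nat.succ_le_of_lt hk) le_rfl
    rw [hL.grid_last] at this
    exact Finset.mem_Icc.2 ⟨by omega, by simp at this; omega⟩
  -- The history cut to the times `1, …, t - 1`, with a dummy value elsewhere. It is measurable for
  -- `pastSigma`, which ignores time `0` and the times from `t` on.
  set Y : Ω → ℕ → Observation d K := fun ω s =>
    if s ∈ Finset.Ico 1 t then observation θ X a ε s ω else (0, 0, 0) with hY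
  have hYh : ∀ ω, ∀ s ∈ Finset.Ico 1 t, Y ω s = history θ X a ε ω s := fun ω s hs => by
    simp only [hY, if_pos hs]; rfl
  have hXm := hrun.measurable_context t
  have ham := hrun.measurable_arm t
  have hεm := hrun.measurable_noise t
  have hYpast : Measurable[pastSigma θ X a ε t] Y := by
    refine @measurable_pi_lambda _ _ _ (pastSigma θ X a ε t) _ _ fun s => ?_
    by_cases hs : s ∈ Finset.Ico 1 t
    · simp only [hY, if_pos hs]
      refine Measurable.mono (comap_measurable _) ?_ le_rfl
      exact le_iSup₂_of_le s hs le_rfl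
    · simp only [hY, if_neg hs]
      exact @measurable_const _ _ _ (pastSigma θ X a ε t) _
  have hpast : pastSigma θ X a ε t ≤ (inferInstance : MeasurableSpace Ω) :=
    iSup₂_le fun s _ => (hrun.measurable_observation s).comap_le
  have hYm : Measurable Y := hYpast.mono hpast le_rfl
  have hm2 : pastSigma θ X a ε t ⊔ MeasurableSpace.comap (X t) inferInstance
      ≤ (inferInstance : MeasurableSpace Ω) := sup_le hpast hXm.comap_le
  have hYX : Measurable[pastSigma θ X a ε t ⊔ MeasurableSpace.comap (X t) inferInstance]
      fun ω => (Y ω, X t ω) :=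
    Measurable.prodMk (m := pastSigma θ X a ε t ⊔ MeasurableSpace.comap (X t) inferInstance)
      (hYpast.mono le_sup_left le_rfl) ((comap_measurable (X t)).mono le_sup_right le_rfl)
  have hindε : IndepFun (fun ω => ((Y ω, X t ω), a t ω)) (ε t) μ := by
    refine (IndepFun_iff_Indep _ _ _).2 (indep_of_indep_of_le_left (hrun.noise_indep t htT).symm ?_)
    refine Measurable.comap_le (m₁ := pastSigma θ X a ε t ⊔ MeasurableSpace.comap (X t)
      inferInstance ⊔ MeasurableSpace.comap (a t) inferInstance) ?_
    exact Measurable.prodMk (m := pastSigma θ X a ε t ⊔ MeasurableSpace.comap (X t)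
      inferInstance ⊔ MeasurableSpace.comap (a t) inferInstance) (hYX.mono le_sup_left le_rfl)
      ((comap_measurable (a t)).mono le_sup_right le_rfl)
  have hindX : IndepFun Y (X t) μ :=
    (IndepFun_iff_Indep _ _ _).2 (indep_of_indep_of_le_left (hrun.context_indep t htT).symm
      hYpast.comap_le)
  have hpol : ∀ ω, L.policy (k + 1) (Y ω) = L.policy (k + 1) (history θ X a ε ω) := fun ω =>
    hL.policy_congr k hk _ _ fun s hs => hYh ω s (by
      rw [Finset.mem_Icc] at hs; rw [Finset.mem_Ico]; omega)
  have hupd : ∀ ω z, g (Function.update (Y ω) t z)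
      = g (Function.update (history θ X a ε ω) t z) := fun ω z => hgt fun s hs => by
    by_cases hst : s = t
    · simp [hst]
    · rw [Function.update_of_ne hst, Function.update_of_ne hst]
      exact hYh ω s (Finset.mem_Ico.2 ⟨hs.1, lt_of_le_of_ne hs.2 hst⟩)
  set F : (((ℕ → Observation d K) × Contexts d K) × Fin K) × ℝ → ℝ≥0∞ := fun p =>
    g (Function.update p.1.1.1 t (toObs θ ((p.1.1.2, p.1.2), p.2))) with hF
  have hFm : Measurable F := by
    refine hg.comp ?_
    have h1 : Measurable fun p : (((ℕ → Observation d K) × Contexts d K) × Fin K) × ℝ =>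
      (p.1.1.1, toObs θ ((p.1.1.2, p.1.2), p.2)) :=
      (by fun_prop : Measurable fun p : (((ℕ → Observation d K) × Contexts d K) × Fin K) × ℝ =>
        p.1.1.1).prodMk ((measurable_toObs θ).comp (by fun_prop))
    exact (measurable_update' (a := t)).comp h1
  have hobs : ∀ ω, g (history θ X a ε ω) = F (((Y ω, X t ω), a t ω), ε t ω) := fun ω => by
    simp only [hF]
    rw [hupd]
    congr 1
    refine (Function.update_eq_self t _).symm.trans ?_
    rfl
  set η := μ.map (ε t) with hη
  have : IsProbabilityMeasure η := Measure.isProbabilityMeasure_map hεm.aemeasurable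
  set G : ((ℕ → Observation d K) × Contexts d K) × Fin K → ℝ≥0∞ := fun p => ∫⁻ e, F (p, e) ∂η
    with hG
  have hGm : Measurable G := hFm.lintegral_prod_right'
  have hGi : ∀ i, Measurable fun p : (ℕ → Observation d K) × Contexts d K => G (p, i) := fun i =>
    hGm.comp (by fun_prop)
  -- Integrate in reverse order of generation: the noise by independence, the arm by its conditional
  -- law, the contexts by independence of the past.
  calc ∫⁻ ω, g (history θ X a ε ω) ∂μ
      = ∫⁻ ω, G ((Y ω, X t ω), a t ω) ∂μ := by
        simp only [hobs]
        exact lintegral_eq_lintegral_of_indepFun ((hYm.prodMk hXm).prodMk ham) hεm hindε hFm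
    _ = ∑ i, ∫⁻ ω in a t ⁻¹' {i}, G ((Y ω, X t ω), i) ∂μ := by
        have h1 : (Set.univ : Set Ω) = ⋃ i ∈ (Finset.univ : Finset (Fin K)), a t ⁻¹' {i} := by
          ext ω; simp
        rw [← setLIntegral_univ, h1, lintegral_biUnion_finset]
        · refine Finset.sum_congr rfl fun i _ => ?_
          refine setLIntegral_congr_fun (ham (measurableSet_singleton i)) fun ω hω => ?_
          simp only [Set.mem_preimage, Set.mem_singleton_iff] at hω
          simp only [hω]
        · intro i _ j _ hij
          exact Disjoint.preimage _ (by simpa using hij)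
        · intro i _
          exact ham (measurableSet_singleton i)
    _ = ∑ i, ∫⁻ ω, L.policy (k + 1) (Y ω) (X t ω) i * G ((Y ω, X t ω), i) ∂μ := by
        refine Finset.sum_congr rfl fun i _ => ?_
        refine setLIntegral_eq_of_condExp hm2 (ham (measurableSet_singleton i))
          (P := fun ω => L.policy (k + 1) (Y ω) (X t ω) i) ?_ (fun ω => PMF.coe_le_one _ _) ?_
          (W := fun ω => G ((Y ω, X t ω), i)) ((hGi i).comp hYX)
        · exact (hmeas (k + 1) i).comp (hYm.prodMk hXm)
        · refine (hrun.arm_law k hk t ht i).trans (Filter.Eventually.of_forall fun ω => ?_)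
          simp only [hpol]
          rfl
    _ = ∑ i, ∫⁻ ω, ∫⁻ x, L.policy (k + 1) (Y ω) x i * G ((Y ω, x), i) ∂D ∂μ := by
        refine Finset.sum_congr rfl fun i _ => ?_
        rw [← hrun.context_law t htT]
        exact lintegral_eq_lintegral_of_indepFun hYm hXm hindX
          (f := fun p => L.policy (k + 1) p.1 p.2 i * G (p, i)) ((hmeas (k + 1) i).mul (hGi i))
    _ = ∫⁻ ω, ∑ i, ∫⁻ x, L.policy (k + 1) (Y ω) x i * G ((Y ω, x), i) ∂D ∂μ := by
        rw [lintegral_finsetSum]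
        intro i _
        exact (((hmeas (k + 1) i).mul (hGi i)).lintegral_prod_right').comp hYm
    _ = _ := by
        refine lintegral_congr fun ω => ?_
        have hgu : Measurable fun z => g (Function.update (history θ X a ε ω) t z) :=
          hg.comp (measurable_update _)
        rw [BatchLearner.stepLaw, lintegral_obsLaw _ _ _ hgu, lintegral_armLaw _ (hmeas.policy _ _)]
        · refine Finset.sum_congr rfl fun i _ => lintegral_congr fun x => ?_
          simp only [hpol, hG, hF, hupd]
          rfl
        · exact (hgu.comp (measurable_toObs θ)).lintegral_prod_right'

theorem BatchLearner.isProbabilityMeasure_stepLaw [IsProbabilityMeasure D]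
    (hmeas : L.MeasurablePolicy) {η : ℕ → Measure ℝ} (hη : ∀ t, IsProbabilityMeasure (η t)) (k : ℕ)
    (h : ℕ → Observation d K) (t : ℕ) : IsProbabilityMeasure (L.stepLaw D θ η k h t) := by
  have := isProbabilityMeasure_armLaw D (hmeas.policy k h)
  exact isProbabilityMeasure_obsLaw _ _ _

theorem BatchLearner.lintegral_stepLaw (hmeas : L.MeasurablePolicy) {η : ℕ → Measure ℝ}
    (hη : ∀ t, IsProbabilityMeasure (η t)) (k : ℕ) (h : ℕ → Observation d K) (t : ℕ)
    {f : Observation d K → ℝ≥0∞} (hf : Measurable f) :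
    ∫⁻ z, f z ∂L.stepLaw D θ η k h t
      = ∑ i, ∫⁻ x, L.policy k h x i * ∫⁻ e, f (toObs θ ((x, i), e)) ∂η t ∂D := by
  rw [BatchLearner.stepLaw, lintegral_obsLaw _ _ _ hf, lintegral_armLaw _ (hmeas.policy k h)]
  exact (hf.comp (measurable_toObs θ)).lintegral_prod_right'

/-- In the expansion over the arms, the law depends on `h` only through the policy weights, so
measurability in `h` follows from that of the policy. -/
theorem BatchLearner.measurable_lintegral_stepLaw [IsProbabilityMeasure D]
    (hmeas : L.MeasurablePolicy) {η : ℕ → Measure ℝ} (hη : ∀ t, IsProbabilityMeasure (η t))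
    (k t : ℕ) {g : (ℕ → Observation d K) → ℝ≥0∞} (hg : Measurable g) :
    Measurable fun h => ∫⁻ z, g (Function.update h t z) ∂L.stepLaw D θ η k h t := by
  have h1 : ∀ h : ℕ → Observation d K, ∫⁻ z, g (Function.update h t z) ∂L.stepLaw D θ η k h t
      = ∑ i, ∫⁻ x, L.policy k h x i
        * ∫⁻ e, g (Function.update h t (toObs θ ((x, i), e))) ∂η t ∂D := fun h =>
    BatchLearner.lintegral_stepLaw hmeas hη k h t (hg.comp (measurable_update h))
  simp only [h1]
  refine Finset.measurable_fun_sum _ fun i _ => ?_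
  have h2 : Measurable fun p : ((ℕ → Observation d K) × Contexts d K) × ℝ =>
      g (Function.update p.1.1 t (toObs θ ((p.1.2, i), p.2))) := by
    have h3 : Measurable fun p : ((ℕ → Observation d K) × Contexts d K) × ℝ =>
        (p.1.1, toObs θ ((p.1.2, i), p.2)) :=
      (by fun_prop : Measurable fun p : ((ℕ → Observation d K) × Contexts d K) × ℝ =>
        p.1.1).prodMk ((measurable_toObs θ).comp (by fun_prop))
    exact hg.comp ((measurable_update' (a := t)).comp h3)
  exact ((hmeas k i).mul h2.lintegral_prod_right').lintegral_prod_right'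

theorem BatchLearner.IsBatched.stepLaw_congr (hL : L.IsBatched T) {k : ℕ}
    (hk : k < L.numBatches) (η : ℕ → Measure ℝ) {h h' : ℕ → Observation d K}
    (hh : ∀ s ∈ Finset.Icc 1 (L.grid k), h s = h' s) :
    L.stepLaw D θ η (k + 1) h = L.stepLaw D θ η (k + 1) h' := by
  funext t
  rw [BatchLearner.stepLaw, BatchLearner.stepLaw, hL.policy_congr k hk h h' hh]

/-- Given the previous batches, the observations of a batch are independent. -/
theorem lintegral_history_batch [NeZero K] [IsProbabilityMeasure μ] [IsProbabilityMeasure D]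
    (hrun : IsBanditRun μ L T D θ X a ε)
    (hL : L.IsBatched T) (hmeas : L.MeasurablePolicy) {k : ℕ} (hk : k < L.numBatches) {n : ℕ}
    (hkn : L.grid k ≤ n) (hn : n ≤ L.grid (k + 1)) {g : (ℕ → Observation d K) → ℝ≥0∞}
    (hg : Measurable g) (hgn : DependsOn g (Set.Icc 1 n)) :
    ∫⁻ ω, g (history θ X a ε ω) ∂μ
      = ∫⁻ ω, lmarginal (L.stepLaw D θ (fun s => μ.map (ε s)) (k + 1) (history θ X a ε ω))
          (Finset.Ioc (L.grid k) n) g (history θ X a ε ω) ∂μ := by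
  have hη : ∀ t, IsProbabilityMeasure (μ.map (ε t)) := fun t =>
    Measure.isProbabilityMeasure_map (hrun.measurable_noise t).aemeasurable
  induction n, hkn using Nat.le_induction generalizing g with
  | base => simp
  | succ n hkn ih =>
    have hn' : n + 1 ∈ Finset.Ioc (L.grid k) (L.grid (k + 1)) :=
      Finset.mem_Ioc.2 ⟨by omega, hn⟩
    -- The latest time is redrawn first; the resulting integral depends only on the times up to `n`,
    -- so the induction hypothesis applies to it.
    rw [lintegral_history_step hrun hL hmeas hk hn' hg hgn,
      ih (by omega) (g := fun h => ∫⁻ z, g (Function.update h (n + 1) z)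
        ∂L.stepLaw D θ (fun s => μ.map (ε s)) (k + 1) h (n + 1))
        (BatchLearner.measurable_lintegral_stepLaw hmeas hη _ _ hg)]
    · refine lintegral_congr fun ω => ?_
      set h := history θ X a ε ω
      have : ∀ t, IsProbabilityMeasure
          (L.stepLaw D θ (fun s => μ.map (ε s)) (k + 1) h t) :=
        BatchLearner.isProbabilityMeasure_stepLaw hmeas hη _ _
      have hins : Finset.Ioc (L.grid k) (n + 1) = insert (n + 1) (Finset.Ioc (L.grid k) n) := by
        ext s; simp only [Finset.mem_Ioc, Finset.mem_insert]; omega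
      rw [hins, lmarginal_insert' _ hg (by simp)]
      refine lintegral_congr fun y => ?_
      beta_reduce
      -- Redrawing times inside the batch leaves the policy of this batch, and hence the step law,
      -- unchanged.
      rw [hL.stepLaw_congr hk _ (h := Function.updateFinset h _ y) (h' := h)]
      intro s hs
      rw [Function.updateFinset_def]
      have : s ∉ Finset.Ioc (L.grid k) n := by
        rw [Finset.mem_Icc] at hs; rw [Finset.mem_Ioc]; omega
      simp only [this, dif_neg, not_false_eq_true]
    · intro h h' hh
      have h1 : L.stepLaw D θ (fun s => μ.map (ε s)) (k + 1) h
          = L.stepLaw D θ (fun s => μ.map (ε s)) (k + 1) h' :=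
        hL.stepLaw_congr hk _ fun s hs => hh s (by
          rw [Finset.mem_Icc] at hs; exact ⟨hs.1, by omega⟩)
      simp only [h1]
      refine lintegral_congr fun z => hgn fun s hs => ?_
      by_cases hsn : s = n + 1
      · simp [hsn]
      · rw [Function.update_of_ne hsn, Function.update_of_ne hsn]
        exact hh s ⟨hs.1, by have := hs.2; omega⟩

end Resampling

/-! ### Regularized Gram matrices of independent random vectors -/

section RandomGram

/-- The formula `det⁻¹ • adjugate` also covers singular matrices, since both sides use the
convention that `0` has inverse `0`. -/
theorem measurable_matrix_inv_apply {α : Type*} [MeasurableSpace α] {d : ℕ}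
    {M : α → Matrix (Fin d) (Fin d) ℝ} (hM : ∀ i j, Measurable fun x => M x i j) (i j : Fin d) :
    Measurable fun x => (M x)⁻¹ i j := by
  have hid : Continuous fun A : Fin d → Fin d → ℝ => Matrix.of A := continuous_id
  have h1 : Measurable fun A : Fin d → Fin d → ℝ =>
      (Matrix.of A).det⁻¹ * (Matrix.of A).adjugate i j :=
    hid.matrix_det.measurable.inv.mul (hid.matrix_adjugate.matrix_elem i j).measurable
  have h2 : Measurable fun x => (fun i j => M x i j : Fin d → Fin d → ℝ) :=
    measurable_pi_lambda _ fun i => measurable_pi_lambda _ fun j => hM i j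
  have h3 := h1.comp h2
  convert h3 using 2 with x
  simp only [Function.comp, Matrix.inv_def, Matrix.smul_apply, Ring.inverse_eq_inv, smul_eq_mul]
  rfl

variable {α ι : Type*} [MeasurableSpace α] {d : ℕ}

theorem measurable_regGram_inv_mulVec (c : ℝ) (s : Finset ι) {z : α → ι → Fin d → ℝ}
    (hz : ∀ t ∈ s, Measurable fun x => z x t) {y : α → Fin d → ℝ} (hy : Measurable y) :
    Measurable fun x => (regGram c s (z x))⁻¹.mulVec (y x) := by
  have hz' : ∀ t ∈ s, ∀ i, Measurable fun x => z x t i := fun t ht i =>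
    (measurable_pi_apply i).comp (hz t ht)
  have hM : ∀ i j, Measurable fun x => regGram c s (z x) i j := fun i j => by
    simp only [regGram, Matrix.add_apply, Matrix.sum_apply, Matrix.vecMulVec_apply]
    exact measurable_const.add
      (Finset.measurable_fun_sum _ fun t ht => (hz' t ht i).mul (hz' t ht j))
  refine measurable_pi_lambda _ fun i => ?_
  simp only [Matrix.mulVec, dotProduct]
  exact Finset.measurable_fun_sum _ fun j _ =>
    (measurable_matrix_inv_apply hM i j).mul ((measurable_pi_apply j).comp hy)

theorem measurable_dotProduct {u v : α → Fin d → ℝ} (hu : Measurable u) (hv : Measurable v) :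
    Measurable fun x => dotProduct (u x) (v x) := by
  simp only [dotProduct]
  exact Finset.measurable_fun_sum _ fun j _ =>
    ((measurable_pi_apply j).comp hu).mul ((measurable_pi_apply j).comp hv)

theorem measurable_invQuad (c : ℝ) (s : Finset ι) {z : α → ι → Fin d → ℝ}
    (hz : ∀ t ∈ s, Measurable fun x => z x t) {y : α → Fin d → ℝ} (hy : Measurable y) :
    Measurable fun x => invQuad c s (z x) (y x) :=
  measurable_dotProduct hy (measurable_regGram_inv_mulVec c s hz hy)

theorem regGram_congr (c : ℝ) {s : Finset ι} {z z' : ι → Fin d → ℝ} (h : ∀ t ∈ s, z t = z' t) :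
    regGram c s z = regGram c s z' := by
  rw [regGram, regGram, Finset.sum_congr rfl fun t ht => by rw [h t ht]]

theorem invQuad_congr (c : ℝ) {s : Finset ι} {z z' : ι → Fin d → ℝ} (h : ∀ t ∈ s, z t = z' t)
    (y : Fin d → ℝ) : invQuad c s z y = invQuad c s z' y := by
  rw [invQuad, invQuad, regGram_congr c h]

/-- If `z_t`, `t ∈ s`, are independent random vectors of the unit ball with the same law as `y`
and `Λ = c I + ∑ z_t z_tᵀ` with `1 ≤ c`, then `|s| 𝔼[yᵀ Λ⁻¹ y] ≤ 2 d` for `y` independent of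
the `z_t`. -/
theorem card_mul_lmarginal_lintegral_invQuad_le [DecidableEq ι] {E : Type*} [MeasurableSpace E]
    {c : ℝ} (hc : 1 ≤ c) (s : Finset ι) (ν : ι → Measure E) [∀ i, IsProbabilityMeasure (ν i)]
    {φ : E → Fin d → ℝ} (hφ : Measurable φ) {ρ : Measure (Fin d → ℝ)}
    (hρ : ∀ i ∈ s, (ν i).map φ = ρ) (hnorm : ∀ᵐ y ∂ρ, dotProduct y y ≤ 1) (h : ι → E) :
    s.card * lmarginal ν s (fun h => ∫⁻ y, ENNReal.ofReal (invQuad c s (φ ∘ h) y) ∂ρ) h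
      ≤ 2 * d := by
  rcases s.eq_empty_or_nonempty with rfl | ⟨i₀, hi₀⟩
  · simp
  have : IsProbabilityMeasure ρ := by
    rw [← hρ i₀ hi₀]; exact Measure.isProbabilityMeasure_map hφ.aemeasurable
  have hc0 : 0 < c := by linarith
  have hφt : ∀ t, Measurable fun h : ι → E => φ (h t) := fun t =>
    hφ.comp (measurable_pi_apply t)
  have hQ : ∀ r : Finset ι, Measurable fun p : (ι → E) × (Fin d → ℝ) =>
      ENNReal.ofReal (invQuad c r (φ ∘ p.1) p.2) := fun r =>
    (measurable_invQuad c r (z := fun p : (ι → E) × (Fin d → ℝ) => φ ∘ p.1)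
      (fun t _ => (hφt t).comp measurable_fst) measurable_snd).ennreal_ofReal
  have hone : ∀ j, Measurable fun h : ι → E => ENNReal.ofReal (invQuad c s (φ ∘ h) (φ (h j))) :=
    fun j => (hQ s).comp (measurable_id.prodMk (hφt j))
  have hint : ∀ r : Finset ι, Measurable fun h : ι → E =>
      ∫⁻ y, ENNReal.ofReal (invQuad c r (φ ∘ h) y) ∂ρ := fun r => (hQ r).lintegral_prod_right'
  -- The exchange argument for one index `j`: leave `z_j` out, let it play the role of `y`, then put
  -- it back.
  have key : ∀ j ∈ s,
      lmarginal ν s (fun h => ∫⁻ y, ENNReal.ofReal (invQuad c s (φ ∘ h) y) ∂ρ) h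
        ≤ lmarginal ν s (fun h => 2 * ENNReal.ofReal (invQuad c s (φ ∘ h) (φ (h j)))) h := by
    intro j hj
    have hins : insert j (s.erase j) = s := Finset.insert_erase hj
    calc lmarginal ν s (fun h => ∫⁻ y, ENNReal.ofReal (invQuad c s (φ ∘ h) y) ∂ρ) h
        ≤ lmarginal ν s
            (fun h => ∫⁻ y, ENNReal.ofReal (invQuad c (s.erase j) (φ ∘ h) y) ∂ρ) h := by
          refine lmarginal_mono (fun h => lintegral_mono fun y => ENNReal.ofReal_le_ofReal ?_) h
          have := invQuad_insert_le hc0 (Finset.notMem_erase j s) (φ ∘ h) y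
          rwa [hins] at this
      _ ≤ lmarginal ν s (fun h => 2 * ENNReal.ofReal (invQuad c s (φ ∘ h) (φ (h j)))) h := by
          -- Coordinate `j` is integrated innermost. The matrix built from `s.erase j` does not see
          -- it, so the integral over `y` can be rewritten as one over `φ z` with `z` of law `ν j`.
          rw [lmarginal_erase' _ (hint _) hj, lmarginal_erase' _ ((hone j).const_mul 2) hj]
          refine lmarginal_mono (fun h => ?_) h
          have hcongr : ∀ z y, invQuad c (s.erase j) (φ ∘ Function.update h j z) y
              = invQuad c (s.erase j) (φ ∘ h) y := fun z y =>
            invQuad_congr c (fun t ht => by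
              simp [Function.update_of_ne (Finset.ne_of_mem_erase ht)]) y
          simp only [hcongr, lintegral_const, measure_univ, mul_one]
          have hy : Measurable fun y => ENNReal.ofReal (invQuad c (s.erase j) (φ ∘ h) y) :=
            (hQ (s.erase j)).comp (measurable_const.prodMk measurable_id)
          rw [← hρ j hj, lintegral_map hy hφ]
          have hae : ∀ᵐ z ∂ν j, dotProduct (φ z) (φ z) ≤ 1 := by
            rw [← hρ j hj] at hnorm
            exact ae_of_ae_map hφ.aemeasurable hnorm
          refine lintegral_mono_ae (hae.mono fun z hz => ?_)
          have h1 := invQuad_le_two_mul_insert hc (Finset.notMem_erase j s)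
            (φ ∘ Function.update h j z) (by simpa using hz)
          rw [hins] at h1
          simp only [Function.comp_apply, Function.update_self] at h1
          rw [hcongr] at h1
          simp only [Function.update_self]
          refine (ENNReal.ofReal_le_ofReal h1).trans (le_of_eq ?_)
          rw [ENNReal.ofReal_mul (by norm_num)]
          simp
  calc s.card * lmarginal ν s (fun h => ∫⁻ y, ENNReal.ofReal (invQuad c s (φ ∘ h) y) ∂ρ) h
      = ∑ j ∈ s, lmarginal ν s (fun h => ∫⁻ y, ENNReal.ofReal (invQuad c s (φ ∘ h) y) ∂ρ) h := by
        rw [Finset.sum_const, nsmul_eq_mul]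
    _ ≤ ∑ j ∈ s, lmarginal ν s (fun h => 2 * ENNReal.ofReal (invQuad c s (φ ∘ h) (φ (h j)))) h :=
        Finset.sum_le_sum key
    _ = lmarginal ν s
          (fun h => ∑ j ∈ s, 2 * ENNReal.ofReal (invQuad c s (φ ∘ h) (φ (h j)))) h := by
        simp only [lmarginal]
        rw [lintegral_finsetSum]
        exact fun j _ => ((hone j).const_mul 2).comp measurable_updateFinset
    _ ≤ lmarginal ν s (fun _ => 2 * d) h := by
        refine lmarginal_mono (fun h => ?_) h
        rw [← Finset.mul_sum, ← ENNReal.ofReal_sum_of_nonneg fun j _ => invQuad_nonneg hc0 _ _ _]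
        gcongr
        refine ENNReal.ofReal_le_of_le_toReal ?_
        simpa using sum_invQuad_le hc0 s (φ ∘ h)
    _ = 2 * d := by simp [lmarginal]

/-- A two-sided Chernoff bound for a linear combination of independent sub-Gaussian variables. -/
theorem measure_pi_abs_sum_gt_le {κ : Type*} [Fintype κ] (η : κ → Measure ℝ)
    [∀ i, IsProbabilityMeasure (η i)] (hη : ∀ i, HasSubgaussianMGF id 1 (η i)) (w : κ → ℝ)
    {W B : ℝ} (hW : ∑ i, w i ^ 2 ≤ W) (hB : 0 ≤ B) :
    Measure.pi η {e | B * Real.sqrt W < |∑ i, w i * e i|}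
      ≤ ENNReal.ofReal (2 * Real.exp (-B ^ 2 / 2)) := by
  have hsum0 : 0 ≤ ∑ i, w i ^ 2 := Finset.sum_nonneg fun i _ => sq_nonneg _
  -- The Chernoff exponent divides by the sum of squares. If all weights vanish, the strict
  -- inequality makes the event empty.
  rcases hsum0.eq_or_lt with h0 | hpos
  · have hw : ∀ i, w i = 0 := fun i => by
      have h1 := (Finset.sum_eq_zero_iff_of_nonneg fun i _ => sq_nonneg (w i)).1
        h0.symm i (Finset.mem_univ i)
      simpa using h1
    have hnn : ¬ B * Real.sqrt W < 0 := not_lt.2 (by positivity)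
    simp [hw, hnn]
  have hind : iIndepFun (fun i (e : κ → ℝ) => e i) (Measure.pi η) :=
    iIndepFun_pi (X := fun _ x => x) fun i => aemeasurable_id
  -- The sign `σ = ±1` treats both tails at once.
  have hsub : ∀ σ : ℝ, σ ^ 2 = 1 → (Measure.pi η).real {e | B * Real.sqrt W ≤ ∑ i, σ * w i * e i}
      ≤ Real.exp (-B ^ 2 / 2) := by
    intro σ hσ
    have hi : iIndepFun (fun i (e : κ → ℝ) => σ * w i * e i) (Measure.pi η) :=
      hind.comp (fun i x => σ * w i * x) fun i => by fun_prop
    have hs : ∀ i ∈ (Finset.univ : Finset κ), HasSubgaussianMGF (fun e : κ → ℝ => σ * w i * e i)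
        (⟨(σ * w i) ^ 2, sq_nonneg _⟩ * 1) (Measure.pi η) := fun i _ => by
      refine HasSubgaussianMGF.const_mul ?_ (σ * w i)
      have hm : (Measure.pi η).map (fun e => e i) = η i := (measurePreserving_eval η i).map_eq
      rw [← HasSubgaussianMGF.id_map_iff (measurable_pi_apply i).aemeasurable, hm]
      exact hη i
    refine (HasSubgaussianMGF.measure_sum_ge_le_of_iIndepFun hi hs (by positivity)).trans ?_
    have h2 : (2 * ∑ i, (((⟨(σ * w i) ^ 2, sq_nonneg _⟩ * 1 : NNReal)) : ℝ)) = 2 * ∑ i, w i ^ 2 := by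
      congr 1
      refine Finset.sum_congr rfl fun i _ => ?_
      change (σ * w i) ^ 2 * 1 = w i ^ 2
      rw [mul_pow, hσ, one_mul, mul_one]
    push_cast at h2 ⊢
    rw [h2, Real.exp_le_exp, mul_pow, Real.sq_sqrt (hsum0.trans hW)]
    rw [div_le_div_iff₀ (by positivity) (by norm_num)]
    nlinarith [mul_le_mul_of_nonneg_left hW (sq_nonneg B)]
  have hsubset : {e : κ → ℝ | B * Real.sqrt W < |∑ i, w i * e i|}
      ⊆ {e | B * Real.sqrt W ≤ ∑ i, 1 * w i * e i} ∪ {e | B * Real.sqrt W ≤ ∑ i, (-1) * w i * e i} := by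
    intro e he
    simp only [Set.mem_ofPred_eq, Set.mem_union] at he ⊢
    have h1 : ∑ i, (-1) * w i * e i = -∑ i, w i * e i := by
      rw [← Finset.sum_neg_distrib]; exact Finset.sum_congr rfl fun i _ => by ring
    simp only [one_mul, h1]
    rcases lt_abs.1 he with h | h
    · exact Or.inl h.le
    · exact Or.inr h.le
  refine (measure_mono hsubset).trans ((measure_union_le _ _).trans ?_)
  rw [two_mul, ENNReal.ofReal_add (Real.exp_pos _).le (Real.exp_pos _).le]
  have e1 := hsub 1 (by norm_num)
  have e2 := hsub (-1) (by norm_num)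
  rw [measureReal_def] at e1 e2
  exact add_le_add (ENNReal.le_ofReal_iff_toReal_le (measure_ne_top _ _) (Real.exp_pos _).le |>.2 e1)
    (ENNReal.le_ofReal_iff_toReal_le (measure_ne_top _ _) (Real.exp_pos _).le |>.2 e2)

end RandomGram

/-! ### The noise part of the ridge estimator -/

section RidgeNoise

variable {d K : ℕ}

/-- The context vector of the arm played in an observation. -/
def Observation.vec (o : Observation d K) : Fin d → ℝ := (o.1 o.2.1).ofLp

theorem Observation.measurable_vec :
    Measurable (Observation.vec : Observation d K → Fin d → ℝ) :=
  (by fun_prop : Measurable fun x : EuclideanSpace ℝ (Fin d) => x.ofLp).comp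
    (measurable_playedContext.comp (by fun_prop : Measurable fun o : Observation d K =>
      ((o.1, o.2.1) : Contexts d K × Fin K)))

theorem inner_eq_dotProduct (x y : EuclideanSpace ℝ (Fin d)) :
    inner ℝ x y = dotProduct y.ofLp x.ofLp := by
  rw [EuclideanSpace.inner_eq_star_dotProduct, star_trivial]

theorem dotProduct_self_eq_norm_sq (x : EuclideanSpace ℝ (Fin d)) :
    dotProduct x.ofLp x.ofLp = ‖x‖ ^ 2 := by
  rw [← inner_eq_dotProduct, real_inner_self_eq_norm_sq]

/-- The noise part of the error of the ridge estimator at `y`, for independent observations with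
sub-Gaussian noise. -/
theorem measure_pi_ridge_noise_le {κ : Type*} [Fintype κ] (θ : EuclideanSpace ℝ (Fin d))
    (α : Measure (Contexts d K × Fin K)) [IsProbabilityMeasure α] (η : κ → Measure ℝ)
    [∀ i, IsProbabilityMeasure (η i)] (hη : ∀ i, HasSubgaussianMGF id 1 (η i))
    {c : ℝ} (hc : 0 < c) (y : Fin d → ℝ) {B : ℝ} (hB : 0 ≤ B) :
    Measure.pi (fun i => obsLaw θ α (η i))
      {o | B * Real.sqrt (invQuad c Finset.univ (fun i => (o i).vec) y)
        < |∑ i, dotProduct y ((regGram c Finset.univ fun i => (o i).vec)⁻¹.mulVec (o i).vec)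
            * ((o i).2.2 - dotProduct (o i).vec θ.ofLp)|}
      ≤ ENNReal.ofReal (2 * Real.exp (-B ^ 2 / 2)) := by
  have := fun i => isProbabilityMeasure_obsLaw θ α (η i)
  set S := {o : κ → Observation d K |
      B * Real.sqrt (invQuad c Finset.univ (fun i => (o i).vec) y)
        < |∑ i, dotProduct y ((regGram c Finset.univ fun i => (o i).vec)⁻¹.mulVec (o i).vec)
            * ((o i).2.2 - dotProduct (o i).vec θ.ofLp)|} with hS
  have hvec : ∀ i : κ, Measurable fun o : κ → Observation d K => (o i).vec := fun i =>
    Observation.measurable_vec.comp (measurable_pi_apply i)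
  have hSm : MeasurableSet S := by
    refine measurableSet_lt ((measurable_invQuad c Finset.univ
      (z := fun (o : κ → Observation d K) i => (o i).vec) (fun t _ => hvec t)
      measurable_const).sqrt.const_mul B) ?_
    have : Measurable fun o : κ → Observation d K =>
        ∑ i, dotProduct y ((regGram c Finset.univ fun i => (o i).vec)⁻¹.mulVec (o i).vec)
            * ((o i).2.2 - dotProduct (o i).vec θ.ofLp) := by
      refine Finset.measurable_fun_sum _ fun i _ => ?_
      refine (measurable_dotProduct measurable_const (measurable_regGram_inv_mulVec c Finset.univ
        (z := fun (o : κ → Observation d K) i => (o i).vec) (fun t _ => hvec t) (hvec i))).mul ?_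
      exact (by fun_prop : Measurable fun o : κ → Observation d K => (o i).2.2).sub
        (measurable_dotProduct (hvec i) measurable_const)
    exact this.abs
  have hmap : Measure.pi (fun i => obsLaw θ α (η i))
      = (Measure.pi fun i => α.prod (η i)).map fun p i => toObs θ (p i) := by
    have : ∀ i, SigmaFinite ((α.prod (η i)).map (toObs θ)) := fun i => by
      have := isProbabilityMeasure_obsLaw θ α (η i)
      rw [obsLaw] at this
      infer_instance
    exact (Measure.pi_map_pi (f := fun _ => toObs θ)
      fun i => (measurable_toObs θ).aemeasurable).symm
  have htm : Measurable fun (p : κ → (Contexts d K × Fin K) × ℝ) i => toObs θ (p i) :=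
    measurable_pi_lambda _ fun i => (measurable_toObs θ).comp (measurable_pi_apply i)
  -- Separate the contexts and arms of the whole batch from its noises. For frozen contexts and arms
  -- `z`, the matrix and the weights are deterministic, and the scalar Chernoff bound applies to the
  -- noises.
  have harr := (measurePreserving_arrowProdEquivProdArrow (Contexts d K × Fin K) ℝ κ
    (fun _ => α) η).symm
  rw [hmap, Measure.map_apply htm hSm, ← harr.map_eq, Measure.map_apply
    (MeasurableEquiv.measurable _) (htm hSm), Measure.prod_apply
    (MeasurableEquiv.measurable _ (htm hSm))]
  refine (lintegral_mono fun z => ?_).trans (le_of_eq (by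
    rw [lintegral_const, measure_univ, mul_one]))
  refine (measure_mono ?_).trans (measure_pi_abs_sum_gt_le η hη
    (fun i => dotProduct y ((regGram c Finset.univ fun i => ((z i).1 (z i).2).ofLp)⁻¹.mulVec
      ((z i).1 (z i).2).ofLp))
    (sum_dotProduct_inv_mulVec_sq_le hc Finset.univ _ y) hB)
  intro e he
  have hobs : ∀ i, toObs θ ((z i), e i) = ((z i).1, (z i).2,
      inner ℝ θ ((z i).1 (z i).2) + e i) := fun i => rfl
  have he' : (fun i => toObs θ (z i, e i)) ∈ S := he
  simpa only [hS, Set.mem_ofPred_eq, hobs, Observation.vec, inner_eq_dotProduct,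
    add_sub_cancel_left] using he'

end RidgeNoise

/-! ### Elimination under correct confidence intervals -/

namespace BatchLinUCB

variable {d K : ℕ}

theorem played_eq (h : ℕ → Observation d K) (t : ℕ) : played h t = (h t).vec := rfl

theorem infoMatrix_eq (T : ℕ) (δ : ℝ) (h : ℕ → Observation d K) (k : ℕ) :
    infoMatrix T δ h k
      = regGram (lam d T δ) (Finset.Ioc (grid T (k - 1)) (grid T k)) (fun t => (h t).vec) := rfl

theorem width_eq (T : ℕ) (δ : ℝ) (h : ℕ → Observation d K) (k : ℕ)
    (x : EuclideanSpace ℝ (Fin d)) :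
    width T δ h k x = alpha d K T δ * Real.sqrt (invQuad (lam d T δ)
      (Finset.Ioc (grid T (k - 1)) (grid T k)) (fun t => (h t).vec) x.ofLp) := rfl

theorem estimate_congr (T : ℕ) (δ : ℝ) {h h' : ℕ → Observation d K} {k : ℕ}
    (hh : ∀ t ∈ Finset.Ioc (grid T (k - 1)) (grid T k), h t = h' t) :
    estimate T δ h k = estimate T δ h' k := by
  rw [estimate, estimate, infoMatrix_eq, infoMatrix_eq,
    regGram_congr _ (z' := fun t => (h' t).vec) fun t ht => by rw [hh t ht]]
  congr 1
  exact Finset.sum_congr rfl fun t ht => by rw [played_eq, played_eq, hh t ht]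

theorem width_congr (T : ℕ) (δ : ℝ) {h h' : ℕ → Observation d K} {k : ℕ}
    (hh : ∀ t ∈ Finset.Ioc (grid T (k - 1)) (grid T k), h t = h' t)
    (x : EuclideanSpace ℝ (Fin d)) : width T δ h k x = width T δ h' k x := by
  rw [width_eq, width_eq,
    invQuad_congr _ (z' := fun t => (h' t).vec) fun t ht => by rw [hh t ht]]

theorem survivors_congr (T : ℕ) (δ : ℝ) {h h' : ℕ → Observation d K} (x : Contexts d K) (k : ℕ)
    (hh : ∀ κ < k, ∀ t ∈ Finset.Ioc (grid T κ) (grid T (κ + 1)), h t = h' t) :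
    survivors T δ h x k = survivors T δ h' x k := by
  induction k with
  | zero => rfl
  | succ k ih =>
    have hk := hh k (Nat.lt_succ_self k)
    ext i
    simp only [survivors, Finset.mem_filter]
    simp only [ih fun κ hκ => hh κ (by omega), estReward,
      estimate_congr T δ (k := k + 1) hk, width_congr T δ (k := k + 1) hk]

theorem survivors_succ_subset (T : ℕ) (δ : ℝ) (h : ℕ → Observation d K) (x : Contexts d K)
    (k : ℕ) : survivors T δ h x (k + 1) ⊆ survivors T δ h x k := by
  rw [survivors]
  exact Finset.filter_subset _ _

/-- As long as all confidence intervals are correct, an optimal arm survives. -/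
theorem mem_survivors_of_isMax (T : ℕ) (δ : ℝ) (h : ℕ → Observation d K) (x : Contexts d K)
    (θ : Fin d → ℝ) {k : ℕ}
    (hconf : ∀ κ < k, ∀ j, |estReward T δ h (κ + 1) (x j) - dotProduct (x j).ofLp θ|
      ≤ width T δ h (κ + 1) (x j)) {i : Fin K}
    (hi : ∀ j, dotProduct (x j).ofLp θ ≤ dotProduct (x i).ofLp θ) :
    i ∈ survivors T δ h x k := by
  induction k with
  | zero => exact Finset.mem_univ _
  | succ k ih =>
    rw [survivors, Finset.mem_filter]
    refine ⟨ih fun κ hκ => hconf κ (by omega), fun j _ => ?_⟩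
    have h1 := abs_le.1 (hconf k (Nat.lt_succ_self k) i)
    have h2 := abs_le.1 (hconf k (Nat.lt_succ_self k) j)
    linarith [hi j, h1.1, h2.2]

/-- The optimal arm `i` survives and does not eliminate `j`, so the gap is at most `2 w_i + 2 w_j`.
Both widths are bounded through the sum over all survivors because the exploration of the batch
controls that sum in expectation. -/
theorem gap_le_of_mem_survivors {T : ℕ} {δ : ℝ} (hlam : 0 < lam d T δ)
    (h : ℕ → Observation d K) (x : Contexts d K)
    (θ : Fin d → ℝ) {k : ℕ}
    (hconf : ∀ κ < k + 1, ∀ j, |estReward T δ h (κ + 1) (x j) - dotProduct (x j).ofLp θ|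
      ≤ width T δ h (κ + 1) (x j)) {i j : Fin K}
    (hi : ∀ j, dotProduct (x j).ofLp θ ≤ dotProduct (x i).ofLp θ)
    (hj : j ∈ survivors T δ h x (k + 1)) :
    dotProduct (x i).ofLp θ - dotProduct (x j).ofLp θ
      ≤ 4 * (alpha d K T δ * Real.sqrt (∑ l ∈ survivors T δ h x k,
          invQuad (lam d T δ) (Finset.Ioc (grid T k) (grid T (k + 1)))
            (fun t => (h t).vec) (x l).ofLp)) := by
  have hw : ∀ l ∈ survivors T δ h x k, width T δ h (k + 1) (x l)
      ≤ alpha d K T δ * Real.sqrt (∑ l ∈ survivors T δ h x k,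
          invQuad (lam d T δ) (Finset.Ioc (grid T k) (grid T (k + 1)))
            (fun t => (h t).vec) (x l).ofLp) := fun l hl => by
    rw [width_eq]
    refine mul_le_mul_of_nonneg_left (Real.sqrt_le_sqrt ?_) (by unfold alpha; positivity)
    exact Finset.single_le_sum (f := fun l => invQuad (lam d T δ)
      (Finset.Ioc (grid T k) (grid T (k + 1))) (fun t => (h t).vec) (x l).ofLp)
      (fun l _ => invQuad_nonneg hlam _ _ _) hl
  have hik : i ∈ survivors T δ h x k :=
    mem_survivors_of_isMax T δ h x θ (fun κ hκ => hconf κ (by omega)) hi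
  have h1 := abs_le.1 (hconf k (Nat.lt_succ_self k) i)
  have h2 := abs_le.1 (hconf k (Nat.lt_succ_self k) j)
  have h3 := hw i hik
  have h4 := hw j (survivors_succ_subset T δ h x k hj)
  rw [survivors, Finset.mem_filter] at hj
  have h5 := hj.2 i hik
  linarith [h1.1, h2.2]

/-! ### Measurability of the algorithm -/

section Measurability

variable (T : ℕ) (δ : ℝ)

theorem measurable_history_vec (t : ℕ) :
    Measurable fun h : ℕ → Observation d K => (h t).vec :=
  Observation.measurable_vec.comp (measurable_pi_apply t)

theorem measurable_estimate (k : ℕ) :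
    Measurable fun h : ℕ → Observation d K => estimate T δ h k := by
  simp only [estimate, infoMatrix_eq, played_eq]
  refine measurable_regGram_inv_mulVec _ _ (z := fun (h : ℕ → Observation d K) t => (h t).vec)
    (fun t _ => measurable_history_vec t) ?_
  refine Finset.measurable_fun_sum _ fun t _ => ?_
  exact (by fun_prop : Measurable fun h : ℕ → Observation d K => (h t).2.2).smul
    (measurable_history_vec t)

theorem measurable_invQuad_history (c : ℝ) (s : Finset ℕ) :
    Measurable fun p : (ℕ → Observation d K) × EuclideanSpace ℝ (Fin d) =>
      invQuad c s (fun t => (p.1 t).vec) p.2.ofLp :=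
  measurable_invQuad c s (z := fun (p : (ℕ → Observation d K) × EuclideanSpace ℝ (Fin d)) t =>
    (p.1 t).vec) (fun t _ => (measurable_history_vec t).comp measurable_fst) (by fun_prop)

theorem measurable_width (k : ℕ) :
    Measurable fun p : (ℕ → Observation d K) × EuclideanSpace ℝ (Fin d) =>
      width T δ p.1 k p.2 := by
  simp only [width_eq]
  exact (measurable_invQuad_history _ _).sqrt.const_mul _

theorem measurable_estReward (k : ℕ) :
    Measurable fun p : (ℕ → Observation d K) × EuclideanSpace ℝ (Fin d) =>
      estReward T δ p.1 k p.2 :=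
  measurable_dotProduct (by fun_prop) ((measurable_estimate T δ k).comp measurable_fst)

theorem measurableSet_mem_survivors (k : ℕ) (i : Fin K) :
    MeasurableSet {p : (ℕ → Observation d K) × Contexts d K | i ∈ survivors T δ p.1 p.2 k} := by
  induction k generalizing i with
  | zero => simp [survivors]
  | succ k ih =>
    simp only [survivors, Finset.mem_filter]
    have hj : ∀ j : Fin K, Measurable fun p : (ℕ → Observation d K) × Contexts d K =>
        (p.1, p.2 j) := fun j => by fun_prop
    refine (ih i).inter (measurableSet_setOfPred.2 (Measurable.forall fun j =>
      (measurableSet_setOfPred.1 (ih j)).imp (measurableSet_setOfPred.1 ?_)))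
    exact measurableSet_le
      (((measurable_estReward T δ _).comp (hj j)).sub ((measurable_width T δ _).comp (hj j)))
      (((measurable_estReward T δ _).comp (hj i)).add ((measurable_width T δ _).comp (hj i)))

theorem measurablePolicy_learner [NeZero K] : (learner d K T δ).MeasurablePolicy := by
  classical
  intro k i
  have hind : ∀ j, Measurable fun p : (ℕ → Observation d K) × Contexts d K =>
      if j ∈ survivors T δ p.1 p.2 (k - 1) then (1 : ℝ≥0∞) else 0 := fun j =>
    Measurable.ite (measurableSet_mem_survivors T δ (k - 1) j) measurable_const measurable_const
  have h : (fun p : (ℕ → Observation d K) × Contexts d K => (learner d K T δ).policy k p.1 p.2 i)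
      = fun p => (if i ∈ survivors T δ p.1 p.2 (k - 1) then (1 : ℝ≥0∞) else 0)
        * (∑ j, if j ∈ survivors T δ p.1 p.2 (k - 1) then (1 : ℝ≥0∞) else 0)⁻¹ := by
    funext p
    simp only [learner, PMF.uniformOfFinset_apply]
    split_ifs <;> simp
  rw [h]
  exact (hind i).mul (Finset.measurable_fun_sum _ fun j _ => hind j).inv

end Measurability

end BatchLinUCB

/-! ### The grid of BatchLinUCB -/

namespace BatchLinUCB

variable {T : ℕ}

theorem logb_two_ge (hT : 3 ≤ T) : (3 / 2 : ℝ) ≤ Real.logb 2 T := by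
  have hT' : (3 : ℝ) ≤ T := by exact_mod_cast hT
  rw [Real.le_logb_iff_rpow_le (by norm_num) (by linarith)]
  refine le_trans ?_ hT'
  rw [show (3 / 2 : ℝ) = 3 * (1 / 2) by norm_num, Real.rpow_mul (by norm_num),
    ← Real.sqrt_eq_rpow, Real.sqrt_le_left (by norm_num)]
  norm_num

/-- Keeps `log log T` away from `0`, so that the `+1` of the ceiling in the number of batches is
absorbed into a constant factor. It rests on `√2 ≤ 3/2` and `2 ^ (3/2) ≤ 3`. -/
theorem logb_logb_two_ge (hT : 3 ≤ T) : (1 / 2 : ℝ) ≤ Real.logb 2 (Real.logb 2 T) := by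
  have h := logb_two_ge hT
  rw [Real.le_logb_iff_rpow_le (by norm_num) (by linarith), ← Real.sqrt_eq_rpow]
  refine le_trans ?_ h
  rw [Real.sqrt_le_left (by norm_num)]
  norm_num

theorem numBatches_le (hT : 3 ≤ T) :
    (numBatches T : ℝ) ≤ 3 * Real.logb 2 (Real.logb 2 T) := by
  have h := logb_logb_two_ge hT
  have h2 := (Nat.ceil_lt_add_one (by linarith : 0 ≤ Real.logb 2 (Real.logb 2 T))).le
  unfold numBatches
  linarith

theorem numBatches_pos (hT : 3 ≤ T) : 0 < numBatches T :=
  Nat.ceil_pos.2 (by linarith [logb_logb_two_ge hT])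

/-- The real sequence `T ^ (1 - 2⁻ⁱ)`, of which the grid is the integer part. -/
noncomputable def realGrid (T i : ℕ) : ℝ := (T : ℝ) ^ (1 - (2 : ℝ)⁻¹ ^ i)

theorem realGrid_pos (hT : 3 ≤ T) (i : ℕ) : 0 < realGrid T i :=
  Real.rpow_pos_of_pos (by exact_mod_cast (by omega : 0 < T)) _

theorem one_le_realGrid (hT : 3 ≤ T) (i : ℕ) : 1 ≤ realGrid T i := by
  refine Real.one_le_rpow (by exact_mod_cast (by omega : 1 ≤ T)) ?_
  have : (2 : ℝ)⁻¹ ^ i ≤ 1 := pow_le_one₀ (by norm_num) (by norm_num)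
  linarith

theorem realGrid_zero : realGrid T 0 = 1 := by simp [realGrid]

theorem realGrid_mul_rpow (hT : 3 ≤ T) (i : ℕ) : realGrid T i * (T : ℝ) ^ ((2 : ℝ)⁻¹ ^ i) = T := by
  have hT0 : (0 : ℝ) < T := by exact_mod_cast (by omega : 0 < T)
  rw [realGrid, ← Real.rpow_add hT0]
  simp

theorem realGrid_succ (hT : 3 ≤ T) (i : ℕ) :
    realGrid T (i + 1) = realGrid T i * (T : ℝ) ^ ((2 : ℝ)⁻¹ ^ (i + 1)) := by
  have hT0 : (0 : ℝ) < T := by exact_mod_cast (by omega : 0 < T)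
  rw [realGrid, realGrid, ← Real.rpow_add hT0]
  congr 1
  rw [pow_succ]
  ring

/-- The recursion `u_{i+1} = √(T u_i)` balances the batches: the end `u_{i+1}` of a batch times the
accuracy `1/√u_i` from the previous one is always `√T`. -/
theorem realGrid_succ_sq (hT : 3 ≤ T) (i : ℕ) : realGrid T (i + 1) ^ 2 = T * realGrid T i := by
  have hT0 : (0 : ℝ) < T := by exact_mod_cast (by omega : 0 < T)
  rw [realGrid, realGrid, ← Real.rpow_natCast, ← Real.rpow_mul hT0.le]
  nth_rewrite 2 [← Real.rpow_one (T : ℝ)]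
  rw [← Real.rpow_add hT0]
  congr 1
  push_cast
  rw [pow_succ]
  ring

theorem rpow_eq_two_rpow {x : ℝ} (hx : 0 < x) (r : ℝ) : x ^ r = 2 ^ (Real.logb 2 x * r) := by
  rw [Real.rpow_mul (by norm_num), Real.rpow_logb (by norm_num) (by norm_num) hx]

/-- Below the ceiling one has `i < log log T`, that is `2 ^ i < log T`. These powers are the ratios
of consecutive real grid points. -/
theorem two_lt_rpow (hT : 3 ≤ T) {i : ℕ} (hi : i < numBatches T) :
    2 < (T : ℝ) ^ ((2 : ℝ)⁻¹ ^ i) := by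
  have hT0 : (0 : ℝ) < T := by exact_mod_cast (by omega : 0 < T)
  have h1 : (i : ℝ) < Real.logb 2 (Real.logb 2 T) := Nat.lt_ceil.1 hi
  rw [Real.lt_logb_iff_rpow_lt (by norm_num) (by linarith [logb_two_ge hT]),
    Real.rpow_natCast] at h1
  rw [rpow_eq_two_rpow hT0]
  refine (Real.rpow_one (2 : ℝ)).symm.trans_lt
    (Real.rpow_lt_rpow_of_exponent_lt (by norm_num) ?_)
  rw [inv_pow, ← div_eq_mul_inv, lt_div_iff₀ (by positivity)]
  linarith

/-- The real grid point of index `M` is thus at least `T/2`, so ending the last batch at `T` instead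
costs a factor 2. -/
theorem rpow_numBatches_le_two (hT : 3 ≤ T) : (T : ℝ) ^ ((2 : ℝ)⁻¹ ^ numBatches T) ≤ 2 := by
  have hT0 : (0 : ℝ) < T := by exact_mod_cast (by omega : 0 < T)
  have h1 : Real.logb 2 (Real.logb 2 T) ≤ numBatches T := Nat.le_ceil _
  rw [Real.logb_le_iff_le_rpow (by norm_num) (by linarith [logb_two_ge hT]),
    Real.rpow_natCast] at h1
  rw [rpow_eq_two_rpow hT0]
  refine (Real.rpow_le_rpow_of_exponent_le (by norm_num) ?_).trans_eq (Real.rpow_one (2 : ℝ))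
  rw [inv_pow, ← div_eq_mul_inv, div_le_one (by positivity)]
  exact h1

theorem two_mul_realGrid_lt (hT : 3 ≤ T) {i : ℕ} (hi : i + 1 < numBatches T) :
    2 * realGrid T i < realGrid T (i + 1) := by
  rw [realGrid_succ hT, mul_comm]
  exact mul_lt_mul_of_pos_left (two_lt_rpow hT hi) (realGrid_pos hT i)

theorem grid_zero : grid T 0 = 0 := by simp [grid]

theorem grid_numBatches (hT : 3 ≤ T) : grid T (numBatches T) = T := by
  simp [grid, (numBatches_pos hT).ne']

theorem grid_succ_of_lt {i : ℕ} (hi : i + 1 < numBatches T) :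
    grid T (i + 1) = ⌊realGrid T (i + 1)⌋₊ := by
  simp [grid, hi, realGrid]

theorem grid_le_realGrid (hT : 3 ≤ T) {i : ℕ} (hi : i < numBatches T) :
    (grid T i : ℝ) ≤ realGrid T i := by
  cases i with
  | zero => rw [grid_zero]; exact_mod_cast (realGrid_pos hT 0).le
  | succ i => rw [grid_succ_of_lt hi]; exact Nat.floor_le (realGrid_pos hT _).le

theorem grid_lt_grid_succ (hT : 3 ≤ T) {i : ℕ} (hi : i < numBatches T) :
    grid T i < grid T (i + 1) := by
  have h1 := grid_le_realGrid hT hi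
  have h2 := one_le_realGrid hT i
  rcases (Nat.succ_le_of_lt hi).lt_or_eq with h | h
  · change i + 1 < numBatches T at h
    rw [grid_succ_of_lt h]
    refine Nat.lt_of_succ_le (Nat.le_floor ?_)
    push_cast
    linarith [two_mul_realGrid_lt hT h]
  -- The last point is `T` rather than a floor; here the ratio `T / realGrid T i` is the power
  -- bounded below by `two_lt_rpow`.
  · change i + 1 = numBatches T at h
    rw [h, grid_numBatches hT]
    have h3 := realGrid_mul_rpow hT i
    have h4 := two_lt_rpow hT hi
    have h5 : (grid T i : ℝ) < T := by nlinarith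
    exact_mod_cast h5

theorem grid_succ_le_two_mul (hT : 3 ≤ T) {i : ℕ} (hi : i < numBatches T) :
    (grid T (i + 1) : ℝ) ≤ 2 * realGrid T (i + 1) := by
  rcases (Nat.succ_le_of_lt hi).lt_or_eq with h | h
  · linarith [grid_le_realGrid hT h, realGrid_pos hT (i + 1)]
  · change i + 1 = numBatches T at h
    rw [h, grid_numBatches hT]
    have h3 := realGrid_mul_rpow hT (numBatches T)
    have h4 := rpow_numBatches_le_two hT
    nlinarith [realGrid_pos hT (numBatches T)]

/-- Doubling gives half of the end point up to the 1 lost by the floor; that 1 is absorbed because a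
batch contains at least one step. -/
theorem realGrid_succ_le_four_mul (hT : 3 ≤ T) {i : ℕ} (hi : i + 1 < numBatches T) :
    realGrid T (i + 1) ≤ 4 * ((grid T (i + 1) : ℝ) - grid T i) := by
  have h1 := grid_le_realGrid hT (Nat.lt_of_succ_lt hi)
  have h2 := two_mul_realGrid_lt hT hi
  have h3 : realGrid T (i + 1) < grid T (i + 1) + 1 := by
    rw [grid_succ_of_lt hi]; exact Nat.lt_floor_add_one _
  have h4 : (grid T i : ℝ) + 1 ≤ grid T (i + 1) := by
    exact_mod_cast grid_lt_grid_succ hT (Nat.lt_of_succ_lt hi)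
  linarith

theorem grid_mono (hT : 3 ≤ T) {i j : ℕ} (hij : i ≤ j) (hj : j ≤ numBatches T) :
    grid T i ≤ grid T j := by
  induction j, hij using Nat.le_induction with
  | base => exact le_rfl
  | succ n _ ih => exact (ih (by omega)).trans (grid_lt_grid_succ hT (by omega)).le

theorem le_grid (hT : 3 ≤ T) {i : ℕ} (hi : i ≤ numBatches T) : i ≤ grid T i := by
  induction i with
  | zero => omega
  | succ i ih =>
    have := ih (by omega)
    have := grid_lt_grid_succ hT (show i < numBatches T by omega)
    omega

/-- The survivors of the first `k` eliminations depend on the first `k` batches. -/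
theorem survivors_congr_of_grid {d K : ℕ} (hT : 3 ≤ T) (δ : ℝ) {h h' : ℕ → Observation d K}
    (x : Contexts d K) {k : ℕ} (hk : k ≤ numBatches T)
    (hh : ∀ t ∈ Finset.Icc 1 (grid T k), h t = h' t) :
    survivors T δ h x k = survivors T δ h' x k := by
  refine survivors_congr T δ x k fun κ hκ t ht => hh t ?_
  have := grid_mono hT (Nat.succ_le_of_lt hκ) hk
  rw [Finset.mem_Ioc] at ht
  simp only [Nat.succ_eq_add_one] at this
  rw [Finset.mem_Icc]
  omega

theorem isBatched_learner (d K : ℕ) [NeZero K] (hT : 3 ≤ T) (δ : ℝ) :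
    (learner d K T δ).IsBatched T where
  grid_zero := grid_zero (T := T)
  grid_lt _ hk := grid_lt_grid_succ hT hk
  grid_last := grid_numBatches hT
  policy_congr k hk h h' hh := by
    funext x
    have h1 : survivors T δ h x (k + 1 - 1) = survivors T δ h' x (k + 1 - 1) :=
      survivors_congr_of_grid hT δ x (Nat.le_of_lt hk) hh
    simp only [learner, h1]

/-! ### Numerical bounds -/

/-- The logarithm in the confidence parameters. -/
noncomputable def confLog (d K T : ℕ) (δ : ℝ) : ℝ := Real.log (2 * d * K * T / δ)

variable {d K : ℕ} {δ : ℝ}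

theorem six_le_div (hd : 1 ≤ d) (hK : 1 ≤ K) (hT : 3 ≤ T) (hδ : 0 < δ) (hδ1 : δ < 1) :
    6 * (K : ℝ) ≤ 2 * d * K * T / δ ∧ 2 * (K : ℝ) * T ≤ 2 * d * K * T / δ := by
  have hd' : (1 : ℝ) ≤ d := by exact_mod_cast hd
  have hK' : (1 : ℝ) ≤ K := by exact_mod_cast hK
  have hT' : (3 : ℝ) ≤ T := by exact_mod_cast hT
  have h1 : (K : ℝ) ≤ d * K := by nlinarith
  have h2 : (K : ℝ) * T ≤ d * K * T := by nlinarith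
  have h3 : (K : ℝ) * 3 ≤ K * T := by nlinarith
  constructor <;> rw [le_div_iff₀ hδ] <;> nlinarith

theorem one_le_log_six : (1 : ℝ) ≤ Real.log 6 := by
  rw [Real.le_log_iff_exp_le (by norm_num)]
  linarith [Real.exp_one_lt_three]

theorem one_le_confLog (hd : 1 ≤ d) (hK : 1 ≤ K) (hT : 3 ≤ T) (hδ : 0 < δ) (hδ1 : δ < 1) :
    1 ≤ confLog d K T δ := by
  have h := (six_le_div hd hK hT hδ hδ1).1
  have hK' : (1 : ℝ) ≤ K := by exact_mod_cast hK
  exact one_le_log_six.trans (Real.log_le_log (by norm_num) (by linarith))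

theorem lam_le (hd : 1 ≤ d) (hK : 1 ≤ K) (hT : 3 ≤ T) (hδ : 0 < δ) :
    lam d T δ ≤ 16 * confLog d K T δ := by
  have hd' : (1 : ℝ) ≤ d := by exact_mod_cast hd
  have hK' : (1 : ℝ) ≤ K := by exact_mod_cast hK
  have hT' : (3 : ℝ) ≤ T := by exact_mod_cast hT
  unfold lam confLog
  refine mul_le_mul_of_nonneg_left (Real.log_le_log (by positivity) ?_) (by norm_num)
  refine div_le_div_of_nonneg_right ?_ hδ.le
  have : 0 ≤ (d : ℝ) * T := by positivity
  nlinarith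

theorem one_le_lam (hd : 1 ≤ d) (hT : 3 ≤ T) (hδ : 0 < δ) (hδ1 : δ < 1) : 1 ≤ lam d T δ := by
  have h := one_le_confLog (K := 1) hd le_rfl hT hδ hδ1
  unfold confLog at h
  unfold lam
  simp only [Nat.cast_one, mul_one] at h
  linarith

theorem alpha_eq : alpha d K T δ = 10 * Real.sqrt (confLog d K T δ) := rfl

/-- With `u = dKT/δ ≥ 3`, the extra `ln 2` is at most `ln u`, and passing to base 2 only increases
the logarithm as `ln 2 ≤ 1`. -/
theorem confLog_le (hd : 1 ≤ d) (hK : 1 ≤ K) (hT : 3 ≤ T) (hδ : 0 < δ) (hδ1 : δ < 1) :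
    confLog d K T δ ≤ 2 * Real.logb 2 (d * K * T / δ) := by
  have hK' : (1 : ℝ) ≤ K := by exact_mod_cast hK
  have h := (six_le_div hd hK hT hδ hδ1).1
  set u : ℝ := d * K * T / δ with hu
  have h2 : 2 * d * K * T / δ = 2 * u := by rw [hu]; ring
  rw [h2] at h
  have hu3 : 3 ≤ u := by linarith
  have h3 : confLog d K T δ = Real.log 2 + Real.log u := by
    rw [confLog, h2, Real.log_mul (by norm_num) (by linarith)]
  have h4 : Real.log 2 ≤ Real.log u := Real.log_le_log (by norm_num) (by linarith)
  have h5 : 0 < Real.log 2 := Real.log_pos (by norm_num)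
  have h6 : Real.log 2 ≤ 1 := by linarith [Real.log_two_lt_d9]
  rw [h3, Real.logb, ← mul_div_assoc, le_div_iff₀ h5]
  nlinarith

/-- Since `KT ≤ exp L`, two of the 18 units in the exponent pay for the union bound over batches and
arms and for the length of a batch. -/
theorem exp_confLog_le (hd : 1 ≤ d) (hK : 1 ≤ K) (hT : 3 ≤ T) (hδ : 0 < δ) (hδ1 : δ < 1) :
    Real.exp (-18 * confLog d K T δ) * (K * T) ^ 2 ≤ 1 := by
  have hK' : (1 : ℝ) ≤ K := by exact_mod_cast hK
  have hT' : (3 : ℝ) ≤ T := by exact_mod_cast hT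
  have h := (six_le_div hd hK hT hδ hδ1).2
  have hKT : 0 < (K : ℝ) * T := by positivity
  have h1 : (K : ℝ) * T ≤ Real.exp (confLog d K T δ) := by
    rw [confLog, Real.exp_log (by linarith)]
    linarith
  have h2 : Real.exp (-18 * confLog d K T δ) ≤ Real.exp (-(2 * confLog d K T δ)) :=
    Real.exp_le_exp.2 (by linarith [one_le_confLog hd hK hT hδ hδ1])
  calc Real.exp (-18 * confLog d K T δ) * (K * T) ^ 2
      ≤ Real.exp (-(2 * confLog d K T δ)) * Real.exp (confLog d K T δ) ^ 2 := by gcongr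
    _ = 1 := by rw [← Real.exp_nat_mul, ← Real.exp_add]; simp

end BatchLinUCB

/-! ### The expected regret of BatchLinUCB -/

theorem regGram_univ_coe {ι : Type*} {d : ℕ} (c : ℝ) (s : Finset ι) (z : ι → Fin d → ℝ) :
    regGram c (Finset.univ : Finset s) (fun i => z i) = regGram c s z := by
  rw [regGram, regGram, Finset.sum_coe_sort s fun i => Matrix.vecMulVec (z i) (z i)]

theorem ae_armLaw_norm_le {d K : ℕ} {D : Measure (Contexts d K)} {q : Contexts d K → PMF (Fin K)}
    (hD : ∀ᵐ x ∂D, ∀ i, ‖x i‖ ≤ 1) :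
    ∀ᵐ z ∂armLaw D q, dotProduct (z.1 z.2).ofLp (z.1 z.2).ofLp ≤ 1 := by
  have hm : Measurable fun z : Contexts d K × Fin K =>
      dotProduct (z.1 z.2).ofLp (z.1 z.2).ofLp := by
    have h1 : Measurable fun z : Contexts d K × Fin K => (z.1 z.2).ofLp :=
      (by fun_prop : Measurable fun x : EuclideanSpace ℝ (Fin d) => x.ofLp).comp
        measurable_playedContext
    exact measurable_dotProduct h1 h1
  have hS : MeasurableSet {z : Contexts d K × Fin K |
      ¬ dotProduct (z.1 z.2).ofLp (z.1 z.2).ofLp ≤ 1} :=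
    (measurableSet_le hm measurable_const).compl
  rw [ae_iff, armLaw, Measure.finsetSum_apply]
  refine Finset.sum_eq_zero fun i _ => ?_
  rw [Measure.map_apply (by fun_prop) hS]
  refine withDensity_absolutelyContinuous D _ ?_
  refine measure_mono_null ?_ (ae_iff.1 hD)
  intro x hx hx'
  refine hx ?_
  change dotProduct (x i).ofLp (x i).ofLp ≤ 1
  rw [dotProduct_self_eq_norm_sq]
  exact pow_le_one₀ (norm_nonneg _) (hx' i)

namespace BatchLinUCB

variable {d K T : ℕ} {δ : ℝ}
  {Ω : Type*} [MeasurableSpace Ω] {μ : Measure Ω} [IsProbabilityMeasure μ]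
  {D : Measure (Contexts d K)} [IsProbabilityMeasure D]
  {θ : EuclideanSpace ℝ (Fin d)} {X : ℕ → Ω → Contexts d K}
  {a : ℕ → Ω → Fin K} {ε : ℕ → Ω → ℝ}

/-- The set of histories for which the confidence interval at `y` of the batch `k` fails. -/
def confFail (T : ℕ) (δ : ℝ) (θ : EuclideanSpace ℝ (Fin d)) (k : ℕ) :
    Set ((ℕ → Observation d K) × EuclideanSpace ℝ (Fin d)) :=
  {p | width T δ p.1 k p.2 < |estReward T δ p.1 k p.2 - dotProduct p.2.ofLp θ.ofLp|}

theorem measurableSet_confFail (k : ℕ) :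
    MeasurableSet (confFail T δ θ k : Set ((ℕ → Observation d K) × EuclideanSpace ℝ (Fin d))) :=
  measurableSet_lt (measurable_width T δ k)
    ((measurable_estReward T δ k).sub (measurable_dotProduct (by fun_prop) measurable_const)).abs

/-- The constant 10 in `α` splits as 4 + 6: from `λ ≤ 16 L` the bias uses at most `4 √L` times the
unscaled width, so a failure forces the noise beyond `6 √L` times it. -/
theorem lt_abs_noise_of_confFail [NeZero K] (hd : 1 ≤ d) (hT : 3 ≤ T) (hδ : 0 < δ) (hδ1 : δ < 1)
    (hθ : ‖θ‖ ≤ 1) {k : ℕ} {h : ℕ → Observation d K} {y : EuclideanSpace ℝ (Fin d)}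
    (hbad : (h, y) ∈ confFail T δ θ k) :
    6 * Real.sqrt (confLog d K T δ) * Real.sqrt (invQuad (lam d T δ)
        (Finset.Ioc (grid T (k - 1)) (grid T k)) (fun t => (h t).vec) y.ofLp)
      < |∑ t ∈ Finset.Ioc (grid T (k - 1)) (grid T k),
          dotProduct y.ofLp ((regGram (lam d T δ) (Finset.Ioc (grid T (k - 1)) (grid T k))
            fun t => (h t).vec)⁻¹.mulVec (h t).vec)
          * ((h t).2.2 - dotProduct (h t).vec θ.ofLp)| := by
  have hK : 1 ≤ K := NeZero.one_le
  have hlam : 0 < lam d T δ := by linarith [one_le_lam hd hT hδ hδ1]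
  simp only [confFail, Set.mem_ofPred_eq, width_eq, alpha_eq] at hbad
  have h1 := dotProduct_ridge_sub hlam (Finset.Ioc (grid T (k - 1)) (grid T k))
    (fun t => (h t).vec) y.ofLp θ.ofLp (fun t => (h t).2.2)
  have h2 : estReward T δ h k y - dotProduct y.ofLp θ.ofLp = _ := h1
  rw [h2] at hbad
  have hθ' : dotProduct θ.ofLp θ.ofLp ≤ 1 := by
    rw [dotProduct_self_eq_norm_sq]; exact pow_le_one₀ (norm_nonneg _) hθ
  have h3 := mul_abs_dotProduct_inv_mulVec_le hlam (Finset.Ioc (grid T (k - 1)) (grid T k))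
    (fun t => (h t).vec) y.ofLp θ.ofLp hθ'
  have h4 : Real.sqrt (lam d T δ) ≤ 4 * Real.sqrt (confLog d K T δ) := by
    refine (Real.sqrt_le_sqrt (lam_le (K := K) hd hK hT hδ)).trans (le_of_eq ?_)
    rw [Real.sqrt_mul (by norm_num), show (16 : ℝ) = 4 ^ 2 by norm_num,
      Real.sqrt_sq (by norm_num)]
  have h5 := mul_le_mul_of_nonneg_right h4 (Real.sqrt_nonneg (invQuad (lam d T δ)
        (Finset.Ioc (grid T (k - 1)) (grid T k)) (fun t => (h t).vec) y.ofLp))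
  have h6 := hbad.trans_le (abs_sub _ _)
  rw [abs_mul, abs_of_pos hlam] at h6
  linarith

/-- The confidence intervals of a batch are correct with high probability. -/
theorem lintegral_confFail_le [NeZero K] (hd : 1 ≤ d) (hT : 3 ≤ T) (hδ : 0 < δ) (hδ1 : δ < 1)
    (hθ : ‖θ‖ ≤ 1) (hrun : IsBanditRun μ (learner d K T δ) T D θ X a ε) {k : ℕ}
    (hk : k < numBatches T) (y : EuclideanSpace ℝ (Fin d)) :
    ∫⁻ ω, (confFail T δ θ (k + 1)).indicator 1 (history θ X a ε ω, y) ∂μ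
      ≤ ENNReal.ofReal (2 * Real.exp (-18 * confLog d K T δ)) := by
  have hK : 1 ≤ K := NeZero.one_le
  have hlam : 0 < lam d T δ := by linarith [one_le_lam hd hT hδ hδ1]
  have hL := isBatched_learner d K hT δ
  have hmeas := measurablePolicy_learner (d := d) (K := K) T δ
  have hgt := grid_lt_grid_succ hT hk
  have hind : Measurable ((confFail T δ θ (k + 1)).indicator 1 :
      (ℕ → Observation d K) × EuclideanSpace ℝ (Fin d) → ℝ≥0∞) :=
    measurable_one.indicator (measurableSet_confFail (k + 1))
  have hdep : DependsOn (fun h : ℕ → Observation d K =>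
      ((confFail T δ θ (k + 1)).indicator 1 (h, y) : ℝ≥0∞)) (Set.Icc 1 (grid T (k + 1))) := by
    intro h h' hh
    have hh' : ∀ t ∈ Finset.Ioc (grid T (k + 1 - 1)) (grid T (k + 1)), h t = h' t :=
      fun t ht => hh t (by rw [Finset.mem_Ioc] at ht; exact ⟨by omega, ht.2⟩)
    have hiff : (h, y) ∈ confFail T δ θ (k + 1) ↔ (h', y) ∈ confFail T δ θ (k + 1) := by
      simp only [confFail, Set.mem_ofPred_eq, estReward, estimate_congr T δ hh',
        width_congr T δ hh']
    by_cases hb : (h', y) ∈ confFail T δ θ (k + 1)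
    · simp [hb, hiff.2 hb]
    · simp [hb, mt hiff.1 hb]
  rw [lintegral_history_batch hrun hL hmeas hk hgt.le le_rfl
    (g := fun h => (confFail T δ θ (k + 1)).indicator 1 (h, y))
    (hind.comp (measurable_id.prodMk measurable_const)) hdep]
  refine (lintegral_mono fun ω => ?_).trans (le_of_eq (by
    rw [lintegral_const, measure_univ, mul_one]))
  set h := history θ X a ε ω
  have hη : ∀ t, IsProbabilityMeasure (μ.map (ε t)) := fun t =>
    Measure.isProbabilityMeasure_map (hrun.measurable_noise t).aemeasurable
  have hα := isProbabilityMeasure_armLaw D (hmeas.policy (k + 1) h)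
  set s := Finset.Ioc (grid T k) (grid T (k + 1)) with hs
  have hsub : ∀ i : s, HasSubgaussianMGF id 1 (μ.map (ε i)) := fun i => by
    rw [HasSubgaussianMGF.id_map_iff (hrun.measurable_noise i).aemeasurable]
    refine hrun.noise_subgaussian i ?_
    have h1 := Finset.mem_Ioc.1 i.2
    have h2 := grid_mono hT (Nat.succ_le_of_lt hk) le_rfl
    rw [grid_numBatches hT] at h2
    simp only [Nat.succ_eq_add_one] at h2
    exact Finset.mem_Icc.2 ⟨by omega, by omega⟩
  have hB : (0 : ℝ) ≤ 6 * Real.sqrt (confLog d K T δ) := by positivity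
  have hnoise := measure_pi_ridge_noise_le θ (armLaw D ((learner d K T δ).policy (k + 1) h))
    (fun i : s => μ.map (ε i)) hsub hlam y.ofLp hB
  -- The source of the 18: `6² / 2`.
  have hexp : -(6 * Real.sqrt (confLog d K T δ)) ^ 2 / 2 = -18 * confLog d K T δ := by
    rw [mul_pow, Real.sq_sqrt (by linarith [one_le_confLog hd hK hT hδ hδ1])]
    ring
  rw [hexp] at hnoise
  refine le_trans ?_ hnoise
  change ∫⁻ o, Set.indicator {o : s → Observation d K |
    (Function.updateFinset h s o, y) ∈ confFail T δ θ (k + 1)} 1 o ∂(Measure.pi fun i : s =>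
      obsLaw θ (armLaw D ((learner d K T δ).policy (k + 1) h)) (μ.map (ε i))) ≤ _
  refine (lintegral_indicator_one_le _).trans (measure_mono ?_)
  intro o ho
  have h1 := lt_abs_noise_of_confFail hd hT hδ hδ1 hθ ho
  simp only [Nat.add_sub_cancel] at h1
  rw [← hs] at h1
  have h2 : ∀ i : s, o i = Function.updateFinset h s o i := fun i => by
    simp [Function.updateFinset_def]
  simp only [Set.mem_ofPred_eq, h2]
  rw [← Finset.sum_coe_sort] at h1
  rw [regGram_univ_coe _ s fun t => (Function.updateFinset h s o t).vec, invQuad,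
    regGram_univ_coe _ s fun t => (Function.updateFinset h s o t).vec]
  exact h1

/-- The sum over the arms surviving the first `k` eliminations of the squared (unscaled) widths
of the batch `k + 1`. -/
noncomputable def sumInvQuad (T : ℕ) (δ : ℝ) (k : ℕ) (h : ℕ → Observation d K)
    (x : Contexts d K) : ℝ :=
  ∑ l ∈ survivors T δ h x k, invQuad (lam d T δ) (Finset.Ioc (grid T k) (grid T (k + 1)))
    (fun t => (h t).vec) (x l).ofLp

theorem measurable_sumInvQuad (k : ℕ) :
    Measurable fun p : (ℕ → Observation d K) × Contexts d K => sumInvQuad T δ k p.1 p.2 := by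
  classical
  have h1 : ∀ p : (ℕ → Observation d K) × Contexts d K, sumInvQuad T δ k p.1 p.2
      = ∑ l, if l ∈ survivors T δ p.1 p.2 k then invQuad (lam d T δ)
        (Finset.Ioc (grid T k) (grid T (k + 1))) (fun t => (p.1 t).vec) (p.2 l).ofLp else 0 :=
    fun p => by rw [sumInvQuad, ← Finset.sum_filter]; simp
  simp only [h1]
  refine Finset.measurable_fun_sum _ fun l _ =>
    Measurable.ite (measurableSet_mem_survivors T δ k l) ?_ measurable_const
  exact (measurable_invQuad_history _ _).comp
    (by fun_prop : Measurable fun p : (ℕ → Observation d K) × Contexts d K => (p.1, p.2 l))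

/-- The exploration done in a batch controls the widths of the surviving arms. -/
theorem mul_lintegral_sumInvQuad_le [NeZero K] (hd : 1 ≤ d) (hT : 3 ≤ T) (hδ : 0 < δ)
    (hδ1 : δ < 1) (hD : ∀ᵐ x ∂D, ∀ i, ‖x i‖ ≤ 1)
    (hrun : IsBanditRun μ (learner d K T δ) T D θ X a ε) {k : ℕ} (hk : k < numBatches T) :
    (grid T (k + 1) - grid T k : ℕ)
        * ∫⁻ ω, ∫⁻ x, ENNReal.ofReal (sumInvQuad T δ k (history θ X a ε ω) x) ∂D ∂μ
      ≤ 2 * K * d := by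
  have hlam1 := one_le_lam hd hT hδ hδ1
  have hlam : 0 < lam d T δ := by linarith
  have hL := isBatched_learner d K hT δ
  have hmeas := measurablePolicy_learner (d := d) (K := K) T δ
  have hgt := grid_lt_grid_succ hT hk
  set s := Finset.Ioc (grid T k) (grid T (k + 1)) with hs
  have hm := (measurable_sumInvQuad (d := d) (K := K) (T := T) (δ := δ) k).ennreal_ofReal
  have hdep : DependsOn (fun h : ℕ → Observation d K =>
      ∫⁻ x, ENNReal.ofReal (sumInvQuad T δ k h x) ∂D) (Set.Icc 1 (grid T (k + 1))) := by
    intro h h' hh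
    refine lintegral_congr fun x => ?_
    rw [sumInvQuad, sumInvQuad, survivors_congr_of_grid hT δ x hk.le (h' := h') fun t ht => hh t (by
      rw [Finset.mem_Icc] at ht; exact ⟨ht.1, by omega⟩)]
    congr 1
    refine Finset.sum_congr rfl fun l _ => invQuad_congr _ (fun t ht => ?_) _
    rw [hh t (by rw [Finset.mem_Ioc] at ht; exact ⟨by omega, ht.2⟩)]
  rw [lintegral_history_batch hrun hL hmeas hk hgt.le le_rfl
    (g := fun h => ∫⁻ x, ENNReal.ofReal (sumInvQuad T δ k h x) ∂D)
    hm.lintegral_prod_right' hdep, ← lintegral_const_mul' _ _ (by simp)]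
  refine (lintegral_mono fun ω => ?_).trans (le_of_eq (by
    rw [lintegral_const, measure_univ, mul_one]))
  set h := history θ X a ε ω
  have hη : ∀ t, IsProbabilityMeasure (μ.map (ε t)) := fun t =>
    Measure.isProbabilityMeasure_map (hrun.measurable_noise t).aemeasurable
  have hpol := hmeas.policy (k + 1) h
  have hα := isProbabilityMeasure_armLaw D hpol
  set ψ : Contexts d K × Fin K → Fin d → ℝ := fun z => (z.1 z.2).ofLp with hψ
  have hψm : Measurable ψ :=
    (by fun_prop : Measurable fun x : EuclideanSpace ℝ (Fin d) => x.ofLp).comp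
      measurable_playedContext
  set α := armLaw D ((learner d K T δ).policy (k + 1) h) with hαdef
  set ν := (learner d K T δ).stepLaw D θ (fun t => μ.map (ε t)) (k + 1) h with hν
  have hνp : ∀ t, IsProbabilityMeasure (ν t) :=
    BatchLearner.isProbabilityMeasure_stepLaw hmeas hη _ _
  -- The noise laws may vary with time, but the law of the played vector does not.
  have hρ : ∀ i ∈ s, (ν i).map Observation.vec = α.map ψ := fun i _ => by
    have h1 : ν i = (α.prod (μ.map (ε i))).map (toObs θ) := rfl
    have h2 : (α.prod (μ.map (ε i))).map Prod.fst = α := by simp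
    rw [h1, Measure.map_map Observation.measurable_vec (measurable_toObs θ)]
    nth_rewrite 2 [← h2]
    rw [Measure.map_map hψm measurable_fst]
    rfl
  have hnorm : ∀ᵐ y ∂α.map ψ, dotProduct y y ≤ 1 := by
    have hball : MeasurableSet {y : Fin d → ℝ | dotProduct y y ≤ 1} :=
      measurableSet_le (measurable_dotProduct measurable_id measurable_id) measurable_const
    rw [ae_map_iff hψm.aemeasurable hball]
    exact ae_armLaw_norm_le hD
  have hmain := card_mul_lmarginal_lintegral_invQuad_le hlam1 s ν Observation.measurable_vec
    hρ hnorm h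
  have hcard : s.card = grid T (k + 1) - grid T k := by simp [hs]
  rw [hcard] at hmain
  -- Each survivor is played with probability at least `1/K`, so the sum over survivors is at most
  -- `K` times the mean over a freshly played arm. The survivors depend on earlier batches only, so
  -- resampling this batch leaves them fixed.
  have hle : lmarginal ν s (fun h => ∫⁻ x, ENNReal.ofReal (sumInvQuad T δ k h x) ∂D) h
      ≤ K * lmarginal ν s (fun h' => ∫⁻ y, ENNReal.ofReal
          (invQuad (lam d T δ) s (Observation.vec ∘ h') y) ∂α.map ψ) h := by
    rw [lmarginal, lmarginal, ← lintegral_const_mul' _ _ (by simp)]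
    refine lintegral_mono fun o => ?_
    set h' := Function.updateFinset h s o with hh'
    have hsurv : ∀ x, survivors T δ h' x k = survivors T δ h x k := fun x =>
      survivors_congr_of_grid hT δ x hk.le fun t ht => by
        have : t ∉ s := by rw [Finset.mem_Icc] at ht; rw [hs, Finset.mem_Ioc]; omega
        simp [hh', Function.updateFinset_def, this]
    have hq : Measurable fun y : Fin d → ℝ =>
        ENNReal.ofReal (invQuad (lam d T δ) s (Observation.vec ∘ h') y) :=
      (measurable_invQuad _ s (z := fun _ => Observation.vec ∘ h') (fun t _ => measurable_const)
        measurable_id).ennreal_ofReal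
    have hqi : ∀ i, Measurable fun x : Contexts d K =>
        (learner d K T δ).policy (k + 1) h x i
          * ENNReal.ofReal (invQuad (lam d T δ) s (Observation.vec ∘ h') (x i).ofLp) := fun i =>
      (hpol i).mul (hq.comp (by fun_prop : Measurable fun x : Contexts d K => (x i).ofLp))
    beta_reduce
    rw [lintegral_map hq hψm, hαdef, lintegral_armLaw D hpol
      (f := fun z => ENNReal.ofReal (invQuad (lam d T δ) s (Observation.vec ∘ h') (ψ z)))
      (hq.comp hψm),
      ← lintegral_finsetSum _ fun i _ => hqi i, ← lintegral_const_mul' _ _ (by simp)]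
    refine lintegral_mono fun x => ?_
    rw [sumInvQuad, ENNReal.ofReal_sum_of_nonneg fun l _ => invQuad_nonneg hlam _ _ _,
      hsurv x, Finset.mul_sum]
    refine (Finset.sum_le_sum fun l hl => ?_).trans
      (Finset.sum_le_univ_sum_of_nonneg fun l => zero_le)
    rw [← mul_assoc]
    refine le_mul_of_one_le_left zero_le ?_
    have hp : (learner d K T δ).policy (k + 1) h x l
        = ((survivors T δ h x k).card : ℝ≥0∞)⁻¹ := by
      simp only [learner]
      exact PMF.uniformOfFinset_apply_of_mem _ hl
    rw [hp, ← div_eq_mul_inv, ENNReal.le_div_iff_mul_le (by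
      left; exact_mod_cast (Finset.card_pos.2 ⟨l, hl⟩).ne') (by simp), one_mul]
    exact_mod_cast (Finset.card_le_univ _).trans_eq (Fintype.card_fin K)
  calc _ ≤ ((grid T (k + 1) - grid T k : ℕ) : ℝ≥0∞) * (K * lmarginal ν s (fun h' =>
          ∫⁻ y, ENNReal.ofReal (invQuad (lam d T δ) s (Observation.vec ∘ h') y) ∂α.map ψ) h) := by
        gcongr
        exact hle
    _ = K * (((grid T (k + 1) - grid T k : ℕ) : ℝ≥0∞) * lmarginal ν s (fun h' =>
          ∫⁻ y, ENNReal.ofReal (invQuad (lam d T δ) s (Observation.vec ∘ h') y) ∂α.map ψ) h) := by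
        ring
    _ ≤ K * (2 * d) := by gcongr
    _ = 2 * K * d := by ring

end BatchLinUCB

/-- The regret of one observation. -/
noncomputable def obsRegret {d K : ℕ} (θ : EuclideanSpace ℝ (Fin d)) (o : Observation d K) : ℝ :=
  (⨆ i : Fin K, inner ℝ (o.1 i) θ) - inner ℝ (o.1 o.2.1) θ

theorem measurable_obsRegret {d K : ℕ} (θ : EuclideanSpace ℝ (Fin d)) :
    Measurable (obsRegret θ : Observation d K → ℝ) := by
  have h1 : Measurable fun o : Observation d K => o.1 o.2.1 :=
    measurable_playedContext.comp (by fun_prop : Measurable fun o : Observation d K =>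
      ((o.1, o.2.1) : Contexts d K × Fin K))
  have h2 : Measurable fun o : Observation d K => ⨆ i : Fin K, inner ℝ (o.1 i) θ :=
    Measurable.iSup fun i => by fun_prop
  exact h2.sub (h1.inner measurable_const)

theorem regret_eq_sum_obsRegret {d K : ℕ} {Ω : Type*} (T : ℕ) (θ : EuclideanSpace ℝ (Fin d))
    (X : ℕ → Ω → Contexts d K) (a : ℕ → Ω → Fin K) (ε : ℕ → Ω → ℝ) (ω : Ω) :
    regret T θ X a ω = ∑ t ∈ Finset.Icc 1 T, obsRegret θ (history θ X a ε ω t) := rfl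

theorem exists_obsRegret_eq {d K : ℕ} [NeZero K] (θ : EuclideanSpace ℝ (Fin d))
    (x : Contexts d K) :
    ∃ i, (∀ j, dotProduct (x j).ofLp θ.ofLp ≤ dotProduct (x i).ofLp θ.ofLp) ∧
      ∀ j r, obsRegret θ (x, j, r)
        = dotProduct (x i).ofLp θ.ofLp - dotProduct (x j).ofLp θ.ofLp := by
  obtain ⟨i, hi⟩ := Finite.exists_max fun i => dotProduct (x i).ofLp θ.ofLp
  refine ⟨i, hi, fun j r => ?_⟩
  simp only [obsRegret, inner_eq_dotProduct, dotProduct_comm θ.ofLp]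
  congr 1
  exact le_antisymm (ciSup_le hi)
    (le_ciSup (f := fun i => dotProduct (x i).ofLp θ.ofLp) (Set.finite_range _).bddAbove i)

theorem obsRegret_le_two {d K : ℕ} [NeZero K] {θ : EuclideanSpace ℝ (Fin d)} (hθ : ‖θ‖ ≤ 1)
    {x : Contexts d K} (hx : ∀ i, ‖x i‖ ≤ 1) (j : Fin K) (r : ℝ) :
    obsRegret θ (x, j, r) ≤ 2 := by
  obtain ⟨i, -, hi⟩ := exists_obsRegret_eq θ x
  rw [hi j r, dotProduct_comm (x i).ofLp, dotProduct_comm (x j).ofLp, ← inner_eq_dotProduct,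
    ← inner_eq_dotProduct]
  have h : ∀ i, |inner ℝ (x i) θ| ≤ 1 := fun i =>
    (abs_real_inner_le_norm _ _).trans (mul_le_one₀ (hx i) (norm_nonneg _) hθ)
  linarith [(abs_le.1 (h i)).2, (abs_le.1 (h j)).1]

/-! ### Regret of a single time step -/

namespace BatchLinUCB

variable {d K T : ℕ} {δ : ℝ}
  {Ω : Type*} [MeasurableSpace Ω] {μ : Measure Ω} [IsProbabilityMeasure μ]
  {D : Measure (Contexts d K)} [IsProbabilityMeasure D]
  {θ : EuclideanSpace ℝ (Fin d)} {X : ℕ → Ω → Contexts d K}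
  {a : ℕ → Ω → Fin K} {ε : ℕ → Ω → ℝ}

theorem lintegral_obsRegret_le_two {D : Measure (Contexts d K)} [NeZero K]
    (hD : ∀ᵐ x ∂D, ∀ i, ‖x i‖ ≤ 1) (hθ : ‖θ‖ ≤ 1)
    (hrun : IsBanditRun μ (learner d K T δ) T D θ X a ε) {t : ℕ} (ht : t ∈ Finset.Icc 1 T) :
    ∫⁻ ω, ENNReal.ofReal (obsRegret θ (history θ X a ε ω t)) ∂μ ≤ 2 := by
  have hX : ∀ᵐ ω ∂μ, ∀ i, ‖X t ω i‖ ≤ 1 := by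
    rw [← hrun.context_law t ht] at hD
    exact ae_of_ae_map (hrun.measurable_context t).aemeasurable hD
  refine (lintegral_mono_ae (g := fun _ => 2) (hX.mono fun ω hω => ?_)).trans (by simp)
  refine ENNReal.ofReal_le_of_le_toReal ?_
  exact (obsRegret_le_two hθ hω (a t ω) _).trans_eq (by simp)

/-- The number of failures of the confidence intervals of the arms in the first `k` batches. -/
noncomputable def failCount (T : ℕ) (δ : ℝ) (θ : EuclideanSpace ℝ (Fin d)) (k : ℕ)
    (h : ℕ → Observation d K) (x : Contexts d K) : ℝ≥0∞ :=
  ∑ κ ∈ Finset.range k, ∑ l, (confFail T δ θ (κ + 1)).indicator 1 (h, x l)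

theorem measurable_indicator_confFail (k : ℕ) (l : Fin K) :
    Measurable fun p : (ℕ → Observation d K) × Contexts d K =>
      ((confFail T δ θ k).indicator 1 (p.1, p.2 l) : ℝ≥0∞) :=
  (measurable_one.indicator (measurableSet_confFail k)).comp
    (by fun_prop : Measurable fun p : (ℕ → Observation d K) × Contexts d K => (p.1, p.2 l))

theorem measurable_failCount (k : ℕ) :
    Measurable fun p : (ℕ → Observation d K) × Contexts d K => failCount T δ θ k p.1 p.2 :=
  Finset.measurable_fun_sum _ fun κ _ => Finset.measurable_fun_sum _ fun l _ =>
    measurable_indicator_confFail (κ + 1) l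

/-- After exchanging the integrals the contexts are fixed, and the confidence bound at a
deterministic vector is summed over batches and arms. -/
theorem lintegral_failCount_le [NeZero K] (hd : 1 ≤ d) (hT : 3 ≤ T) (hδ : 0 < δ) (hδ1 : δ < 1)
    (hθ : ‖θ‖ ≤ 1) (hrun : IsBanditRun μ (learner d K T δ) T D θ X a ε) {k : ℕ}
    (hk : k ≤ numBatches T) :
    ∫⁻ ω, ∫⁻ x, failCount T δ θ k (history θ X a ε ω) x ∂D ∂μ
      ≤ ENNReal.ofReal (2 * k * K * Real.exp (-18 * confLog d K T δ)) := by
  have hm : Measurable fun p : Ω × Contexts d K =>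
      failCount T δ θ k (history θ X a ε p.1) p.2 := by
    have h1 : Measurable fun p : Ω × Contexts d K => (history θ X a ε p.1, p.2) :=
      (hrun.measurable_history.comp measurable_fst).prodMk measurable_snd
    have h2 := (measurable_failCount (T := T) (δ := δ) (θ := θ) k).comp h1
    exact h2
  rw [lintegral_lintegral_swap (f := fun ω x => failCount T δ θ k (history θ X a ε ω) x)
    hm.aemeasurable]
  refine (lintegral_mono fun x => ?_).trans (le_of_eq (by
    rw [lintegral_const, measure_univ, mul_one]))
  have hFx : ∀ κ l, Measurable fun ω =>
      ((confFail T δ θ (κ + 1)).indicator 1 (history θ X a ε ω, x l) : ℝ≥0∞) := fun κ l => by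
    have h1 : Measurable fun ω => (history θ X a ε ω, x) :=
      hrun.measurable_history.prodMk measurable_const
    have h2 := (measurable_indicator_confFail (T := T) (δ := δ) (θ := θ) (κ + 1) l).comp h1
    exact h2
  simp only [failCount]
  rw [lintegral_finsetSum _ fun κ _ => Finset.measurable_fun_sum _ fun l _ => hFx κ l]
  have hle : ∀ κ ∈ Finset.range k, ∫⁻ ω, ∑ l,
      ((confFail T δ θ (κ + 1)).indicator 1 (history θ X a ε ω, x l) : ℝ≥0∞) ∂μ
      ≤ K * ENNReal.ofReal (2 * Real.exp (-18 * confLog d K T δ)) := fun κ hκ => by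
    rw [lintegral_finsetSum _ fun l _ => hFx κ l]
    refine (Finset.sum_le_sum fun l _ => lintegral_confFail_le hd hT hδ hδ1 hθ hrun
      (by rw [Finset.mem_range] at hκ; omega) (x l)).trans (le_of_eq ?_)
    simp
  refine (Finset.sum_le_sum hle).trans (le_of_eq ?_)
  rw [Finset.sum_const, Finset.card_range, nsmul_eq_mul]
  rw [show 2 * (k : ℝ) * K * Real.exp (-18 * confLog d K T δ)
      = (k : ℝ) * (K * (2 * Real.exp (-18 * confLog d K T δ))) by ring,
    ENNReal.ofReal_mul (Nat.cast_nonneg _), ENNReal.ofReal_mul (Nat.cast_nonneg _),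
    ENNReal.ofReal_natCast, ENNReal.ofReal_natCast]

/-- Pointwise regret bound: the surviving widths plus an indicator of the failure of a confidence
interval. -/
theorem ofReal_obsRegret_le [NeZero K] (hd : 1 ≤ d) (hT : 3 ≤ T) (hδ : 0 < δ) (hδ1 : δ < 1)
    (hθ : ‖θ‖ ≤ 1) {k : ℕ} (h : ℕ → Observation d K) {x : Contexts d K}
    (hx : ∀ i, ‖x i‖ ≤ 1) {j : Fin K} (hj : j ∈ survivors T δ h x (k + 1)) (r : ℝ) {b : ℝ}
    (hb : 0 < b) :
    ENNReal.ofReal (obsRegret θ (x, j, r))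
      ≤ ENNReal.ofReal (2 * alpha d K T δ * b)
        + ENNReal.ofReal (2 * alpha d K T δ / b) * ENNReal.ofReal (sumInvQuad T δ k h x)
        + 2 * failCount T δ θ (k + 1) h x := by
  have hlam : 0 < lam d T δ := by linarith [one_le_lam hd hT hδ hδ1]
  have hα : 0 ≤ alpha d K T δ := by unfold alpha; positivity
  by_cases hconf : ∀ κ < k + 1, ∀ l, (h, x l) ∉ confFail T δ θ (κ + 1)
  · refine le_add_right ?_
    have hS : 0 ≤ sumInvQuad T δ k h x :=
      Finset.sum_nonneg fun l _ => invQuad_nonneg hlam _ _ _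
    obtain ⟨i, hi, hreg⟩ := exists_obsRegret_eq θ x
    have h1 := gap_le_of_mem_survivors hlam h x θ.ofLp
      (fun κ hκ l => not_lt.1 (hconf κ hκ l)) hi hj
    rw [← ENNReal.ofReal_mul (by positivity), ← ENNReal.ofReal_add (by positivity)
      (by positivity), hreg]
    refine ENNReal.ofReal_le_ofReal (h1.trans ?_)
    change 4 * (alpha d K T δ * Real.sqrt (sumInvQuad T δ k h x)) ≤ _
    set S := sumInvQuad T δ k h x
    -- The AM–GM inequality makes the bound linear in `S`, so that expectations can be taken without
    -- Jensen's inequality; `b` is optimized later.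
    have h2 : 2 * Real.sqrt S ≤ b + S / b := by
      rw [← sub_nonneg]
      have h3 : b + S / b - 2 * Real.sqrt S = (b - Real.sqrt S) ^ 2 / b := by
        field_simp
        rw [sub_sq, Real.sq_sqrt hS]
        ring
      rw [h3]
      positivity
    calc 4 * (alpha d K T δ * Real.sqrt S) = 2 * alpha d K T δ * (2 * Real.sqrt S) := by ring
      _ ≤ 2 * alpha d K T δ * (b + S / b) := by gcongr
      _ = _ := by ring
  · push Not at hconf
    obtain ⟨κ, hκ, l, hl⟩ := hconf
    refine le_add_left ?_
    calc ENNReal.ofReal (obsRegret θ (x, j, r)) ≤ ENNReal.ofReal 2 :=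
          ENNReal.ofReal_le_ofReal (obsRegret_le_two hθ hx j r)
      _ = 2 * (confFail T δ θ (κ + 1)).indicator 1 (h, x l) := by simp [hl]
      _ ≤ _ := by
        gcongr
        rw [failCount]
        refine le_trans ?_ (Finset.single_le_sum (fun _ _ => zero_le) (Finset.mem_range.2 hκ))
        exact Finset.single_le_sum (f := fun l =>
          ((confFail T δ θ (κ + 1)).indicator 1 (h, x l) : ℝ≥0∞))
          (fun _ _ => zero_le) (Finset.mem_univ l)

/-- Integrates the pointwise bound over one step with fresh contexts. Batch `k + 2` plays the
survivors of `k + 1` eliminations, while the width term sums over the survivors of `k` eliminations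
with the matrix of batch `k + 1`. -/
theorem lintegral_stepLaw_obsRegret_le [NeZero K] (hd : 1 ≤ d) (hT : 3 ≤ T) (hδ : 0 < δ)
    (hδ1 : δ < 1) (hD : ∀ᵐ x ∂D, ∀ i, ‖x i‖ ≤ 1) (hθ : ‖θ‖ ≤ 1) {η : ℕ → Measure ℝ}
    (hη : ∀ t, IsProbabilityMeasure (η t)) (k t : ℕ) (h : ℕ → Observation d K) {b : ℝ}
    (hb : 0 < b) :
    ∫⁻ z, ENNReal.ofReal (obsRegret θ z) ∂(learner d K T δ).stepLaw D θ η (k + 2) h t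
      ≤ ENNReal.ofReal (2 * alpha d K T δ * b)
        + ENNReal.ofReal (2 * alpha d K T δ / b)
          * ∫⁻ x, ENNReal.ofReal (sumInvQuad T δ k h x) ∂D
        + 2 * ∫⁻ x, failCount T δ θ (k + 1) h x ∂D := by
  have hmeas := measurablePolicy_learner (d := d) (K := K) T δ
  have hR : Measurable fun o : Observation d K => ENNReal.ofReal (obsRegret θ o) :=
    (measurable_obsRegret θ).ennreal_ofReal
  have hF : Measurable fun x => failCount T δ θ (k + 1) h x := by
    have h1 : Measurable fun x : Contexts d K => (h, x) := measurable_const.prodMk measurable_id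
    have h2 := (measurable_failCount (T := T) (δ := δ) (θ := θ) (k + 1)).comp h1
    exact h2
  have hsplit : ∫⁻ x, (ENNReal.ofReal (2 * alpha d K T δ * b)
        + ENNReal.ofReal (2 * alpha d K T δ / b) * ENNReal.ofReal (sumInvQuad T δ k h x)
        + 2 * failCount T δ θ (k + 1) h x) ∂D
      = ENNReal.ofReal (2 * alpha d K T δ * b)
        + ENNReal.ofReal (2 * alpha d K T δ / b)
          * ∫⁻ x, ENNReal.ofReal (sumInvQuad T δ k h x) ∂D
        + 2 * ∫⁻ x, failCount T δ θ (k + 1) h x ∂D := by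
    rw [lintegral_add_right _ (hF.const_mul 2), lintegral_add_left measurable_const,
      lintegral_const_mul' _ _ ENNReal.ofReal_ne_top, lintegral_const_mul 2 hF,
      lintegral_const, measure_univ, mul_one]
  rw [← hsplit, BatchLearner.lintegral_stepLaw hmeas hη _ _ _ hR, ← lintegral_finsetSum]
  · refine lintegral_mono_ae (hD.mono fun x hx => ?_)
    set B := ENNReal.ofReal (2 * alpha d K T δ * b)
      + ENNReal.ofReal (2 * alpha d K T δ / b) * ENNReal.ofReal (sumInvQuad T δ k h x)
      + 2 * failCount T δ θ (k + 1) h x with hB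
    have hsum : ∑ i, (learner d K T δ).policy (k + 2) h x i = 1 := by
      rw [← tsum_fintype (L := .unconditional _)]
      exact PMF.tsum_coe _
    calc _ ≤ ∑ i, (learner d K T δ).policy (k + 2) h x i * B := by
          refine Finset.sum_le_sum fun i _ => ?_
          by_cases hi : i ∈ survivors T δ h x (k + 1)
          · gcongr
            refine (lintegral_mono fun e =>
              ofReal_obsRegret_le hd hT hδ hδ1 hθ h hx hi _ hb).trans ?_
            rw [lintegral_const, measure_univ, mul_one]
          · have h0 : (learner d K T δ).policy (k + 2) h x i = 0 := by
              simp only [learner]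
              exact PMF.uniformOfFinset_apply_of_notMem _ hi
            simp [h0]
      _ = B := by rw [← Finset.sum_mul, hsum, one_mul]
  · intro i _
    refine (hmeas.policy _ h i).mul ?_
    have : Measurable fun p : Contexts d K × ℝ =>
        ENNReal.ofReal (obsRegret θ (toObs θ ((p.1, i), p.2))) :=
      hR.comp ((measurable_toObs θ).comp (by fun_prop))
    exact this.lintegral_prod_right'

/-- The condition `hbk` makes `b²` the exploration bound on the mean of `sumInvQuad`, so the two
AM–GM terms `2αb` and `(2α/b) b²` coincide and add up to `4αb`. -/
theorem lintegral_obsRegret_le [NeZero K] (hd : 1 ≤ d) (hT : 3 ≤ T) (hδ : 0 < δ) (hδ1 : δ < 1)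
    (hD : ∀ᵐ x ∂D, ∀ i, ‖x i‖ ≤ 1) (hθ : ‖θ‖ ≤ 1)
    (hrun : IsBanditRun μ (learner d K T δ) T D θ X a ε) {k : ℕ} (hk : k + 1 < numBatches T)
    {t : ℕ} (ht : t ∈ Finset.Ioc (grid T (k + 1)) (grid T (k + 2))) {b : ℝ} (hb : 0 < b)
    (hbk : b ^ 2 * ((grid T (k + 1) : ℝ) - grid T k) = 2 * K * d) :
    ∫⁻ ω, ENNReal.ofReal (obsRegret θ (history θ X a ε ω t)) ∂μ
      ≤ ENNReal.ofReal (4 * alpha d K T δ * b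
        + 4 * (k + 1) * K * Real.exp (-18 * confLog d K T δ)) := by
  have hlam : 0 < lam d T δ := by linarith [one_le_lam hd hT hδ hδ1]
  have hα : 0 ≤ alpha d K T δ := by unfold alpha; positivity
  have hL := isBatched_learner d K hT δ
  have hmeas := measurablePolicy_learner (d := d) (K := K) T δ
  have hη : ∀ t, IsProbabilityMeasure (μ.map (ε t)) := fun t =>
    Measure.isProbabilityMeasure_map (hrun.measurable_noise t).aemeasurable
  have hhist := hrun.measurable_history
  have hR : Measurable fun o : Observation d K => ENNReal.ofReal (obsRegret θ o) :=
    (measurable_obsRegret θ).ennreal_ofReal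
  have hstep := lintegral_history_step hrun hL hmeas hk ht
    (g := fun h => ENNReal.ofReal (obsRegret θ (h t))) (hR.comp (measurable_pi_apply t))
    (fun h h' hh => by
      have : t ∈ Set.Icc 1 t := ⟨by rw [Finset.mem_Ioc] at ht; omega, le_rfl⟩
      simp only [hh t this])
  rw [hstep]
  have hS := mul_lintegral_sumInvQuad_le hd hT hδ hδ1 hD hrun (Nat.lt_of_succ_lt hk)
  set I := ∫⁻ ω, ∫⁻ x, ENNReal.ofReal (sumInvQuad T δ k (history θ X a ε ω) x) ∂D ∂μ with hI
  have hI2 : I ≤ ENNReal.ofReal (b ^ 2) := by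
    have hgt := grid_lt_grid_succ hT (Nat.lt_of_succ_lt hk)
    have hn : (0 : ℝ) < (grid T (k + 1) : ℝ) - grid T k := by
      rw [sub_pos]; exact_mod_cast hgt
    have hcast : ((grid T (k + 1) - grid T k : ℕ) : ℝ≥0∞)
        = ENNReal.ofReal ((grid T (k + 1) : ℝ) - grid T k) := by
      rw [← Nat.cast_sub hgt.le, ENNReal.ofReal_natCast]
    rw [hcast, mul_comm, ← ENNReal.le_div_iff_mul_le (by left; simpa using hn) (by simp)] at hS
    refine hS.trans (le_of_eq ?_)
    have h2 : (2 * K * d : ℝ≥0∞) = ENNReal.ofReal (2 * K * d) := by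
      rw [ENNReal.ofReal_mul (by positivity), ENNReal.ofReal_mul (by norm_num)]
      simp
    rw [h2, ← ENNReal.ofReal_div_of_pos hn, ← hbk, mul_div_cancel_right₀ _ hn.ne']
  have hfail := lintegral_failCount_le hd hT hδ hδ1 hθ hrun hk.le
  have hFm : Measurable fun ω => ∫⁻ x, failCount T δ θ (k + 1) (history θ X a ε ω) x ∂D := by
    have h1 := (measurable_failCount (T := T) (δ := δ) (θ := θ) (k + 1)).lintegral_prod_right'
      (ν := D)
    exact h1.comp hhist
  calc _ ≤ ∫⁻ ω, (ENNReal.ofReal (2 * alpha d K T δ * b)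
        + ENNReal.ofReal (2 * alpha d K T δ / b)
          * ∫⁻ x, ENNReal.ofReal (sumInvQuad T δ k (history θ X a ε ω) x) ∂D
        + 2 * ∫⁻ x, failCount T δ θ (k + 1) (history θ X a ε ω) x ∂D) ∂μ := by
        refine lintegral_mono fun ω => ?_
        simp only [Function.update_self]
        exact lintegral_stepLaw_obsRegret_le hd hT hδ hδ1 hD hθ hη k t _ hb
    _ = ENNReal.ofReal (2 * alpha d K T δ * b) + ENNReal.ofReal (2 * alpha d K T δ / b) * I
        + 2 * ∫⁻ ω, ∫⁻ x, failCount T δ θ (k + 1) (history θ X a ε ω) x ∂D ∂μ := by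
        rw [lintegral_add_right _ (hFm.const_mul 2), lintegral_add_left measurable_const,
          lintegral_const_mul' _ _ ENNReal.ofReal_ne_top, lintegral_const_mul' 2 _ (by simp),
          lintegral_const, measure_univ, mul_one]
    _ ≤ ENNReal.ofReal (2 * alpha d K T δ * b)
        + ENNReal.ofReal (2 * alpha d K T δ / b) * ENNReal.ofReal (b ^ 2)
        + ENNReal.ofReal 2
          * ENNReal.ofReal (2 * (k + 1 : ℕ) * K * Real.exp (-18 * confLog d K T δ)) := by
        rw [ENNReal.ofReal_ofNat]
        gcongr
    _ = _ := by
        rw [← ENNReal.ofReal_mul (by positivity), ← ENNReal.ofReal_mul (by norm_num),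
          ← ENNReal.ofReal_add (by positivity) (by positivity),
          ← ENNReal.ofReal_add (by positivity) (by positivity)]
        congr 1
        push_cast
        field_simp
        ring

end BatchLinUCB

/-! ### Summation over the batches -/

namespace BatchLinUCB

variable {d K T : ℕ} {δ : ℝ}

theorem realGrid_one (hT : 3 ≤ T) : realGrid T 1 = Real.sqrt T := by
  have h := realGrid_succ_sq hT 0
  rw [realGrid_zero, mul_one] at h
  rw [← h, Real.sqrt_sq (realGrid_pos hT _).le]

/-- The length of a batch times the width guaranteed by the previous batch. -/
theorem grid_mul_sqrt_le (hT : 3 ≤ T) {k : ℕ} (hk : k + 1 < numBatches T) :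
    (grid T (k + 2) : ℝ) * Real.sqrt (2 * K * d / ((grid T (k + 1) : ℝ) - grid T k))
      ≤ 6 * Real.sqrt (d * K * T) := by
  have hn : (0 : ℝ) < (grid T (k + 1) : ℝ) - grid T k := by
    rw [sub_pos]; exact_mod_cast grid_lt_grid_succ hT (Nat.lt_of_succ_lt hk)
  set n := (grid T (k + 1) : ℝ) - grid T k
  have h1 : (grid T (k + 2) : ℝ) ≤ 2 * realGrid T (k + 2) := grid_succ_le_two_mul hT hk
  have h2 : realGrid T (k + 2) ^ 2 = T * realGrid T (k + 1) := realGrid_succ_sq hT (k + 1)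
  have h3 : realGrid T (k + 1) ≤ 4 * n := realGrid_succ_le_four_mul hT hk
  have h4 : (grid T (k + 2) : ℝ) ^ 2 ≤ 16 * T * n := by
    calc (grid T (k + 2) : ℝ) ^ 2 ≤ (2 * realGrid T (k + 2)) ^ 2 := by gcongr
      _ = 4 * T * realGrid T (k + 1) := by rw [mul_pow, h2]; ring
      _ ≤ 4 * T * (4 * n) := by gcongr
      _ = _ := by ring
  refine abs_le_of_sq_le_sq' ?_ (by positivity) |>.2
  -- After squaring, the left side is at most `32 dKT`, below `6² dKT`.
  rw [mul_pow, mul_pow, Real.sq_sqrt (by positivity), Real.sq_sqrt (by positivity)]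
  calc (grid T (k + 2) : ℝ) ^ 2 * (2 * K * d / n) ≤ 16 * T * n * (2 * K * d / n) := by gcongr
    _ = 32 * (d * K * T) := by field_simp; ring
    _ ≤ _ := by
        have : (0 : ℝ) ≤ d * K * T := by positivity
        linarith

theorem one_le_mul_cast (hd : 1 ≤ d) (hK : 1 ≤ K) (hT : 3 ≤ T) :
    (T : ℝ) ≤ d * K * T ∧ (1 : ℝ) ≤ d * K * T := by
  have hT' : (3 : ℝ) ≤ T := by exact_mod_cast hT
  have h : (1 : ℝ) ≤ d * K := by exact_mod_cast Nat.one_le_iff_ne_zero.2 (by positivity)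
  constructor <;> nlinarith

section

variable {Ω : Type*} [MeasurableSpace Ω] {μ : Measure Ω} [IsProbabilityMeasure μ]
  {D : Measure (Contexts d K)} [IsProbabilityMeasure D]
  {θ : EuclideanSpace ℝ (Fin d)} {X : ℕ → Ω → Contexts d K}
  {a : ℕ → Ω → Fin K} {ε : ℕ → Ω → ℝ}

/-- The expected regret of one batch. -/
theorem sum_batch_lintegral_obsRegret_le [NeZero K] (hd : 1 ≤ d) (hT : 3 ≤ T) (hδ : 0 < δ)
    (hδ1 : δ < 1) (hD : ∀ᵐ x ∂D, ∀ i, ‖x i‖ ≤ 1) (hθ : ‖θ‖ ≤ 1)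
    (hrun : IsBanditRun μ (learner d K T δ) T D θ X a ε) {k : ℕ} (hk : k < numBatches T) :
    ∑ t ∈ Finset.Ioc (grid T k) (grid T (k + 1)),
        ∫⁻ ω, ENNReal.ofReal (obsRegret θ (history θ X a ε ω t)) ∂μ
      ≤ ENNReal.ofReal (244 * (Real.sqrt (confLog d K T δ) * Real.sqrt (d * K * T))) := by
  have hK : 1 ≤ K := NeZero.one_le
  have hℓ : 1 ≤ Real.sqrt (confLog d K T δ) :=
    Real.one_le_sqrt.2 (one_le_confLog hd hK hT hδ hδ1)
  have hdKT := one_le_mul_cast hd hK hT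
  have hs1 : 1 ≤ Real.sqrt (d * K * T) := Real.one_le_sqrt.2 hdKT.2
  have hprod : Real.sqrt (d * K * T) ≤ Real.sqrt (confLog d K T δ) * Real.sqrt (d * K * T) :=
    le_mul_of_one_le_left (by positivity) hℓ
  have hcard : ((Finset.Ioc (grid T k) (grid T (k + 1))).card : ℝ) ≤ grid T (k + 1) := by
    rw [Nat.card_Ioc]; exact_mod_cast Nat.sub_le _ _
  have hgT : (grid T (k + 1) : ℝ) ≤ T := by
    have := grid_mono hT (Nat.succ_le_of_lt hk) le_rfl
    rw [grid_numBatches hT] at this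
    exact_mod_cast this
  have hsum : ∀ V : ℝ, (∀ t ∈ Finset.Ioc (grid T k) (grid T (k + 1)),
      ∫⁻ ω, ENNReal.ofReal (obsRegret θ (history θ X a ε ω t)) ∂μ ≤ ENNReal.ofReal V) → 0 ≤ V →
      ∑ t ∈ Finset.Ioc (grid T k) (grid T (k + 1)),
        ∫⁻ ω, ENNReal.ofReal (obsRegret θ (history θ X a ε ω t)) ∂μ
      ≤ ENNReal.ofReal (grid T (k + 1) * V) := fun V h hV => by
    refine (Finset.sum_le_card_nsmul _ _ _ h).trans ?_
    rw [nsmul_eq_mul, ← ENNReal.ofReal_natCast, ← ENNReal.ofReal_mul (Nat.cast_nonneg _)]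
    exact ENNReal.ofReal_le_ofReal (mul_le_mul_of_nonneg_right hcard hV)
  cases k with
  -- Nothing has been learned yet: at most `2√T` steps of regret at most 2 each.
  | zero =>
    refine (hsum 2 (fun t ht => ?_) (by norm_num)).trans (ENNReal.ofReal_le_ofReal ?_)
    · rw [ENNReal.ofReal_ofNat]
      refine lintegral_obsRegret_le_two hD hθ hrun ?_
      rw [Finset.mem_Ioc] at ht
      have h1 : t ≤ T := by exact_mod_cast (Nat.cast_le (α := ℝ).2 ht.2).trans hgT
      exact Finset.mem_Icc.2 ⟨by omega, h1⟩
    · have h1 := grid_succ_le_two_mul hT hk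
      rw [zero_add, realGrid_one hT] at h1
      have h2 : Real.sqrt T ≤ Real.sqrt (d * K * T) := Real.sqrt_le_sqrt hdKT.1
      rw [zero_add]
      linarith
  | succ k =>
    have hn : (0 : ℝ) < (grid T (k + 1) : ℝ) - grid T k := by
      rw [sub_pos]; exact_mod_cast grid_lt_grid_succ hT (Nat.lt_of_succ_lt hk)
    have hdK : (0 : ℝ) < 2 * K * d := by positivity
    set b := Real.sqrt (2 * K * d / ((grid T (k + 1) : ℝ) - grid T k)) with hb
    have hb0 : 0 < b := Real.sqrt_pos.2 (by positivity)
    have hb2 : b ^ 2 * ((grid T (k + 1) : ℝ) - grid T k) = 2 * K * d := by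
      rw [hb, Real.sq_sqrt (by positivity), div_mul_cancel₀ _ hn.ne']
    have hNb : (grid T (k + 2) : ℝ) * b ≤ 6 * Real.sqrt (d * K * T) := grid_mul_sqrt_le hT hk
    refine (hsum _ (fun t ht => lintegral_obsRegret_le hd hT hδ hδ1 hD hθ hrun hk ht hb0 hb2)
      (by rw [alpha_eq]; positivity)).trans (ENNReal.ofReal_le_ofReal ?_)
    have hkT : (k : ℝ) + 1 ≤ T := by
      have h1 := le_grid hT hk.le
      have h2 : ((k + 1 : ℕ) : ℝ) ≤ grid T (k + 1) := by exact_mod_cast h1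
      have h3 : (grid T (k + 1) : ℝ) ≤ grid T (k + 1 + 1) := by
        exact_mod_cast (grid_lt_grid_succ hT hk).le
      push_cast at h2
      linarith
    have hexp := exp_confLog_le hd hK hT hδ hδ1
    have hK' : (1 : ℝ) ≤ K := by exact_mod_cast hK
    set E := Real.exp (-18 * confLog d K T δ) with hE
    have hE0 : 0 ≤ E := (Real.exp_pos _).le
    have hfail : (grid T (k + 1 + 1) : ℝ) * (4 * (k + 1) * K * E) ≤ 4 := by
      calc (grid T (k + 1 + 1) : ℝ) * (4 * (k + 1) * K * E) ≤ T * (4 * T * (K * K) * E) := by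
            gcongr
            exact le_mul_of_one_le_left (by positivity) hK'
        _ = 4 * (E * (K * T) ^ 2) := by ring
        _ ≤ 4 := by linarith
    -- The constant is `244 = 4 · 10 · 6 + 4`: the width term, then the failure term.
    calc (grid T (k + 1 + 1) : ℝ) * (4 * alpha d K T δ * b + 4 * (k + 1) * K * E)
        = 40 * Real.sqrt (confLog d K T δ) * ((grid T (k + 2) : ℝ) * b)
          + (grid T (k + 1 + 1) : ℝ) * (4 * (k + 1) * K * E) := by rw [alpha_eq]; ring
      _ ≤ 40 * Real.sqrt (confLog d K T δ) * (6 * Real.sqrt (d * K * T)) + 4 := by gcongr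
      _ ≤ _ := by linarith

theorem lintegral_regret_le [NeZero K] (hd : 1 ≤ d) (hT : 3 ≤ T) (hδ : 0 < δ)
    (hδ1 : δ < 1) (hD : ∀ᵐ x ∂D, ∀ i, ‖x i‖ ≤ 1) (hθ : ‖θ‖ ≤ 1)
    (hrun : IsBanditRun μ (learner d K T δ) T D θ X a ε) :
    ∫⁻ ω, ENNReal.ofReal (regret T θ X a ω) ∂μ
      ≤ ENNReal.ofReal (numBatches T
          * (244 * (Real.sqrt (confLog d K T δ) * Real.sqrt (d * K * T)))) := by
  set V := 244 * (Real.sqrt (confLog d K T δ) * Real.sqrt (d * K * T)) with hV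
  set f : ℕ → ℝ≥0∞ := fun t =>
    ∫⁻ ω, ENNReal.ofReal (obsRegret θ (history θ X a ε ω t)) ∂μ with hf
  have hind : ∀ m ≤ numBatches T, ∑ t ∈ Finset.Ioc 0 (grid T m), f t ≤ m * ENNReal.ofReal V := by
    intro m hm
    induction m with
    | zero => simp [grid_zero]
    | succ m ih =>
      rw [← Finset.sum_Ioc_consecutive f (Nat.zero_le _) (grid_lt_grid_succ hT hm).le]
      push_cast
      rw [add_mul, one_mul]
      exact add_le_add (ih (by omega))
        (sum_batch_lintegral_obsRegret_le hd hT hδ hδ1 hD hθ hrun hm)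
  have hmeas : ∀ t, Measurable fun ω => ENNReal.ofReal (obsRegret θ (history θ X a ε ω t)) :=
    fun t => ((measurable_obsRegret θ).comp (hrun.measurable_observation t)).ennreal_ofReal
  calc ∫⁻ ω, ENNReal.ofReal (regret T θ X a ω) ∂μ
      ≤ ∫⁻ ω, ∑ t ∈ Finset.Icc 1 T, ENNReal.ofReal (obsRegret θ (history θ X a ε ω t)) ∂μ := by
        refine lintegral_mono fun ω => ?_
        rw [regret_eq_sum_obsRegret T θ X a ε]
        exact Finset.le_sum_of_subadditive _ ENNReal.ofReal_zero.le
          (fun _ _ => ENNReal.ofReal_add_le) _ _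
    _ = ∑ t ∈ Finset.Ioc 0 (grid T (numBatches T)), f t := by
        rw [lintegral_finsetSum _ fun t _ => hmeas t, grid_numBatches hT]
        rfl
    _ ≤ numBatches T * ENNReal.ofReal V := hind _ le_rfl
    _ = _ := by rw [ENNReal.ofReal_mul (Nat.cast_nonneg _), ENNReal.ofReal_natCast]

end

theorem numBatches_mul_le (hd : 1 ≤ d) (hK : 1 ≤ K) (hT : 3 ≤ T) (hδ : 0 < δ) (hδ1 : δ < 1) :
    (numBatches T : ℝ) * (244 * (Real.sqrt (confLog d K T δ) * Real.sqrt (d * K * T)))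
      ≤ 1200 * Real.sqrt (d * K * T * Real.logb 2 (d * K * T / δ))
          * Real.logb 2 (Real.logb 2 T) := by
  have h1 := numBatches_le hT
  have h2 := logb_logb_two_ge hT
  have h3 : Real.sqrt (confLog d K T δ)
      ≤ 3 / 2 * Real.sqrt (Real.logb 2 (d * K * T / δ)) := by
    refine (Real.sqrt_le_sqrt (confLog_le hd hK hT hδ hδ1)).trans ?_
    rw [Real.sqrt_mul (by norm_num)]
    gcongr
    rw [Real.sqrt_le_left (by norm_num)]
    norm_num
  rw [Real.sqrt_mul (show (0 : ℝ) ≤ d * K * T by positivity)]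
  set A := Real.sqrt (Real.logb 2 (d * K * T / δ))
  set B := Real.sqrt ((d : ℝ) * K * T)
  set l := Real.logb 2 (Real.logb 2 (T : ℝ))
  have hAB : 0 ≤ A * B := by positivity
  -- Here 3 comes from the ceiling and `3/2 ≥ √2` from the change of logarithm; `3 · 244 · 3/2 =
  -- 1098`.
  calc _ ≤ 3 * l * (244 * (3 / 2 * A * B)) := by gcongr
    _ = 1098 * (A * B * l) := by ring
    _ ≤ 1200 * (A * B * l) := by nlinarith [mul_nonneg hAB (by linarith : 0 ≤ l)]
    _ = _ := by ring

end BatchLinUCB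

theorem mainTheorem8 :
    ∃ C : ℝ, 0 < C ∧
      ∀ (d K T : ℕ) [NeZero K] (δ : ℝ), 1 ≤ d → 3 ≤ T → 0 < δ → δ < 1 →
        (BatchLinUCB.learner d K T δ).IsBatched T ∧
        ((BatchLinUCB.learner d K T δ).numBatches : ℝ)
          ≤ C * Real.logb 2 (Real.logb 2 (T : ℝ)) ∧
        ∀ (D : Measure (Contexts d K)) (θ : EuclideanSpace ℝ (Fin d))
          (Ω : Type*) [MeasurableSpace Ω] (μ : Measure Ω) [IsProbabilityMeasure μ]
          (X : ℕ → Ω → Contexts d K) (a : ℕ → Ω → Fin K) (ε : ℕ → Ω → ℝ),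
          IsProbabilityMeasure D →
          (∀ᵐ x ∂D, ∀ i, ‖x i‖ ≤ 1) →
          ‖θ‖ ≤ 1 →
          IsBanditRun μ (BatchLinUCB.learner d K T δ) T D θ X a ε →
          hpExpectedRegret μ δ T θ X a
            ≤ ENNReal.ofReal (C * Real.sqrt (d * K * T * Real.logb 2 (d * K * T / δ))
                * Real.logb 2 (Real.logb 2 (T : ℝ))) := by
  refine ⟨1200, by norm_num, fun d K T _ δ hd hT hδ hδ1 =>
    ⟨BatchLinUCB.isBatched_learner d K hT δ, ?_, ?_⟩⟩
  · refine (BatchLinUCB.numBatches_le hT).trans ?_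
    have := BatchLinUCB.logb_logb_two_ge hT
    linarith
  · intro D θ Ω _ μ _ X a ε _ hD hθ hrun
    -- The probability of `A` is not needed: restricting to `A` can only decrease the integral.
    refine iSup_le fun A => iSup_le fun _ => iSup_le fun _ => ?_
    exact (setLIntegral_le_lintegral A _).trans
      ((BatchLinUCB.lintegral_regret_le hd hT hδ hδ1 hD hθ hrun).trans
        (ENNReal.ofReal_le_ofReal
          (BatchLinUCB.numBatches_mul_le hd NeZero.one_le hT hδ hδ1)))
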